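/- **Setting.** Let $(V,\mathcal E)$ be a finite undirected simple graph, let each player $i\in V$ have a finite nonempty action set $S_i$, and for $i,j\in V$ let $A_{ij}\in\mathbb R^{|S_i|\times|S_j|}$ be payoff matrices, with $A_{ij}=0$ when $(i,j)\notin\mathcal E$. Assume that the polymatrix game is zero-sum: $\sum_{i}\sum_{j}A_{ij}(s_i,s_j)=0$ for all $s\in\prod_i S_i$. Write $\|A\|_\infty$ for the largest absolute value of an entry of the $A_{ij}$, $d_{\max}$ for the maximum degree of the graph, $[A_i\pi]_k=\sum_j\sum_{k'\in S_j}A_{ij}(k,k')\pi_j(k')$, and, for $\tau>0$, $$u_{i,\tau}(\pi)=\pi_i^\top A_i\pi+\tau\mathcal H(\pi_i),\qquad \mathcal H(\pi_i)=-\sum_{k}\pi_i(k)\log\pi_i(k).$$ **Delays.** Let $\gamma_i^{(t)}$ ($i\in V$, $t\ge 0$) be mutually independent random variables with values in $\{0,1,2,\dots\}$, let $E(\ell)\ge 0$ satisfy $\mathbb E\big[\gamma_i^{(t)}\mathbf 1\{\gamma_i^{(t)}\ge \ell\}\big]\le E(\ell)$ for all $i$, $t$ and $\ell\ge 0$, and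 let $\sigma>0$ satisfy $\sum_{\ell=0}^\infty E(\ell)\le\sigma^2$. (Consequently $\mathbb E[(\gamma_i^{(t)})^2]\le\sum_\ell E(\ell)\le\sigma^2$.) Put $\kappa_i^{(t)}=\max\{t-\gamma_i^{(t)},0\}$. **Algorithm (single-timescale OMWU).** All players start at the uniform distributions $\pi_i^{(0)}=\overline\pi_i^{(0)}=\frac1{|S_i|}\mathbf 1$ and, for $t\ge 0$, compute the probability vectors $$\overline\pi_i^{(t+1)}(k)\propto\pi_i^{(t)}(k)^{1-\eta\tau}\exp\big(\eta[A_i\overline\pi^{(\kappa_i^{(t)})}]_k\big),\qquad \pi_i^{(t+1)}(k)\propto\pi_i^{(t)}(k)^{1-\eta\tau}\exp\big(\eta[A_i\overline\pi^{(\kappa_i^{(t+1)})}]_k\big).$$ The regret of player $i$ is $$\mathrm{Regret}_i(T)=\max_{p\in\Delta(S_i)}\sum_{t=1}^T u_{i,\tau}\big(p,\overline\pi_{-i}^{(t)}\big)-\sum_{t=1}^T u_{i,\tau}\big(\overline\pi^{(t)}\big).$$ **Theorem.** Assume $0<\tau<\min\{1,\|A\|_\infty\}$ and $0<\eta\le\dfrac{\tau}{24\,d_{\max}^2\|A\|_\infty^2(\sigma^2+1)}$.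 Then for every $T\ge 1$ and every player $i\in V$, the random variable $\mathrm{Regret}_i(T)$ is integrable and $$\mathbb E\big[\mathrm{Regret}_i(T)\big]\le\frac1\eta\log|S_i|+8\,d_{\max}\|A\|_\infty\Big(\frac{d_{\max}\|A\|_\infty}{\tau}+2\Big)(\sigma^2+1)\sum_{j\in V}\log|S_j|.$$ -/

import Mathlib

open MeasureTheory ProbabilityTheory
open scoped ENNReal NNReal Matrix

/-- A strategy profile in vector form: for each player `i`, a real vector indexed by `S i`. -/
abbrev StrategyProfile {V : Type*} (S : V → Type*) : Type _ := ∀ i, S i → ℝ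

/-- A polymatrix game with player set `V` and action sets `S i`: an undirected graph on `V`, and
payoff matrices `A i j` for its edges, with the convention that `A i j = 0` off the edges
(in particular `A i i = 0`). -/
structure PolymatrixGame (V : Type*) (S : V → Type*) where
  graph : SimpleGraph V
  A : ∀ i j, Matrix (S i) (S j) ℝ
  A_eq_zero : ∀ i j, ¬ graph.Adj i j → A i j = 0

/-- The uniform distribution on a finite type. -/
noncomputable def uniformVec (α : Type*) [Fintype α] : α → ℝ := fun _ => 1 / (Fintype.card α : ℝ)

/-- Shannon entropy `-∑ₖ p k log (p k)`, with `0 log 0 = 0`. -/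
noncomputable def shannonEntropy {α : Type*} [Fintype α] (p : α → ℝ) : ℝ :=
  -∑ k, p k * Real.log (p k)

/-- The entropy-regularized multiplicative weights step with payoff vector `g`: the probability
vector proportional to `p k ^ (1 - η τ) * exp (η g k)`. -/
noncomputable def mwuStep {α : Type*} [Fintype α] (η τ : ℝ) (p g : α → ℝ) : α → ℝ := fun k =>
  p k ^ (1 - η * τ) * Real.exp (η * g k) / ∑ k', p k' ^ (1 - η * τ) * Real.exp (η * g k')

namespace PolymatrixGame

variable {V : Type*} {S : V → Type*} [Fintype V] [∀ i, Fintype (S i)]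

/-- The payoff of player `i` when the players choose the pure actions `s`. -/
def pureUtility (G : PolymatrixGame V S) (i : V) (s : ∀ i, S i) : ℝ := ∑ j, G.A i j (s i) (s j)

/-- The payoffs of all players sum to zero for every choice of pure actions. -/
def IsZeroSum (G : PolymatrixGame V S) : Prop :=
  ∀ s : ∀ i, S i, ∑ i, G.pureUtility i s = 0

/-- The payoff vector `A_i π`, whose `k`-th entry is the expected utility of action `k`
for player `i`. -/
def payoffVec (G : PolymatrixGame V S) (i : V) (π : StrategyProfile S) : S i → ℝ :=
  ∑ j, G.A i j *ᵥ π j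

/-- Expected utility `u_i(π) = π_iᵀ A_i π`. -/
def utility (G : PolymatrixGame V S) (i : V) (π : StrategyProfile S) : ℝ :=
  π i ⬝ᵥ G.payoffVec i π

/-- Entropy-regularized utility `u_{i,τ}(π) = u_i(π) + τ H(π_i)`. -/
noncomputable def regUtility (G : PolymatrixGame V S) (τ : ℝ) (i : V) (π : StrategyProfile S) : ℝ :=
  G.utility i π + τ * shannonEntropy (π i)

/-- `‖A‖_∞`: the maximum absolute value of the entries of all payoff matrices. -/
noncomputable def maxPayoff (G : PolymatrixGame V S) : ℝ :=
  ⨆ i, ⨆ j, ⨆ s : S i, ⨆ s' : S j, |G.A i j s s'|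

open Classical in
/-- The maximum degree of the graph. -/
noncomputable def dmax (G : PolymatrixGame V S) : ℕ := G.graph.maxDegree

mutual

/-- The iterates `π^{(t)}` of single-timescale OMWU when `γ i t` is the delay of player `i` in
iteration `t`. Natural-number subtraction gives `κ_i^{(t)} = max (t - γ_i^{(t)}) 0`. -/
noncomputable def omwu (G : PolymatrixGame V S) (η τ : ℝ) (γ : V → ℕ → ℕ) :
    ℕ → StrategyProfile S
  | 0 => fun i => uniformVec (S i)
  | t + 1 => fun i => mwuStep η τ (omwu G η τ γ t i)
      (G.payoffVec i (omwuBar G η τ γ (t + 1 - γ i (t + 1))))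
termination_by t => 2 * t + 1
decreasing_by all_goals omega

/-- The extrapolated iterates `π̄^{(t)}` of single-timescale OMWU. -/
noncomputable def omwuBar (G : PolymatrixGame V S) (η τ : ℝ) (γ : V → ℕ → ℕ) :
    ℕ → StrategyProfile S
  | 0 => fun i => uniformVec (S i)
  | t + 1 => fun i => mwuStep η τ (omwu G η τ γ t i)
      (G.payoffVec i (omwuBar G η τ γ (t - γ i t)))
termination_by t => 2 * t
decreasing_by all_goals omega

end

/-- The cumulative regularized utility over rounds `1, …, T` that player `i` gets with the fixed
strategy `p` when the other players play `x t` in round `t`. -/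
noncomputable def fixedStrategyUtility [DecidableEq V] (G : PolymatrixGame V S) (τ : ℝ)
    (x : ℕ → StrategyProfile S) (i : V) (T : ℕ) (p : S i → ℝ) : ℝ :=
  ∑ t ∈ Finset.Icc 1 T, G.regUtility τ i (Function.update (x t) i p)

/-- The regret of player `i` after `T` rounds along the profiles `x 1, …, x T`. The supremum over
the probability simplex is a maximum, see `isGreatest_fixedStrategyUtility`. -/
noncomputable def regret [DecidableEq V] (G : PolymatrixGame V S) (τ : ℝ)
    (x : ℕ → StrategyProfile S) (i : V) (T : ℕ) : ℝ :=
  sSup (G.fixedStrategyUtility τ x i T '' stdSimplex ℝ (S i))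
    - ∑ t ∈ Finset.Icc 1 T, G.regUtility τ i (x t)

theorem isGreatest_fixedStrategyUtility [DecidableEq V] (G : PolymatrixGame V S) (τ : ℝ)
    (x : ℕ → StrategyProfile S) (i : V) (T : ℕ) [Nonempty (S i)] :
    IsGreatest (G.fixedStrategyUtility τ x i T '' stdSimplex ℝ (S i))
      (sSup (G.fixedStrategyUtility τ x i T '' stdSimplex ℝ (S i))) := by
  classical
  have hc : Continuous (G.fixedStrategyUtility τ x i T) := by
    unfold fixedStrategyUtility regUtility utility payoffVec shannonEntropy
    refine continuous_finsetSum _ fun t _ => ?_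
    have hu : Continuous fun p : S i → ℝ => Function.update (x t) i p :=
      continuous_const.update i continuous_id
    have hl : Continuous fun p : S i → ℝ => ∑ k, p k * Real.log (p k) :=
      continuous_finsetSum _ fun k _ => Real.continuous_mul_log.comp (continuous_apply k)
    simp only [Function.update_self]
    refine Continuous.add ?_ (continuous_const.mul hl.neg)
    refine Continuous.dotProduct continuous_id ?_
    refine continuous_finsetSum _ fun j _ => ?_
    exact Continuous.matrix_mulVec continuous_const ((continuous_apply j).comp hu)
  have hne : (stdSimplex ℝ (S i)).Nonempty :=
    ⟨_, single_mem_stdSimplex ℝ (Classical.arbitrary (S i))⟩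
  exact ((isCompact_stdSimplex ℝ (S i)).image hc).isGreatest_sSup (hne.image _)

end PolymatrixGame

/-- Random delays `γ i t` (player `i`, iteration `t`): mutually independent, with
`𝔼[γ_i^{(t)} 𝟙{γ_i^{(t)} ≥ ℓ}] ≤ E ℓ` for all `ℓ`, and `∑ E ℓ ≤ σ²`. Expectations and the
sum are taken in `[0, ∞]`. The bound `𝔼[(γ_i^{(t)})²] ≤ ∑ E ℓ` is a consequence, see
`RandomDelays.second_moment_le`. -/
structure RandomDelays {V Ω : Type*} [MeasurableSpace Ω] (μ : Measure Ω) (γ : V → ℕ → Ω → ℕ)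
    (E : ℕ → ℝ≥0) (σ : ℝ) : Prop where
  measurable : ∀ i t, Measurable (γ i t)
  indep : iIndepFun (fun q : V × ℕ => γ q.1 q.2) μ
  tail_le : ∀ i t ℓ, ∫⁻ ω in {ω | ℓ ≤ γ i t ω}, (γ i t ω : ℝ≥0∞) ∂μ ≤ E ℓ
  tsum_le : ∑' ℓ, (E ℓ : ℝ≥0∞) ≤ ENNReal.ofReal (σ ^ 2)

theorem RandomDelays.second_moment_le {V Ω : Type*} [MeasurableSpace Ω] {μ : Measure Ω}
    {γ : V → ℕ → Ω → ℕ} {E : ℕ → ℝ≥0} {σ : ℝ} (h : RandomDelays μ γ E σ) (i : V) (t : ℕ) :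
    ∫⁻ ω, (γ i t ω : ℝ≥0∞) ^ 2 ∂μ ≤ ∑' ℓ, (E ℓ : ℝ≥0∞) := by
  have hm : ∀ ℓ, MeasurableSet {ω | ℓ ≤ γ i t ω} := fun ℓ =>
    measurableSet_le measurable_const (h.measurable i t)
  have hg : Measurable fun ω => (γ i t ω : ℝ≥0∞) :=
    (measurable_of_countable (fun n : ℕ => (n : ℝ≥0∞))).comp (h.measurable i t)
  refine le_trans ?_ (ENNReal.tsum_le_tsum (h.tail_le i t))
  simp_rw [fun ℓ => (lintegral_indicator (μ := μ) (hm ℓ) fun ω => (γ i t ω : ℝ≥0∞)).symm]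
  rw [← lintegral_tsum fun ℓ => (hg.indicator (hm ℓ)).aemeasurable]
  refine lintegral_mono fun ω => ?_
  refine le_trans ?_ (ENNReal.sum_le_tsum (Finset.range (γ i t ω)))
  rw [Finset.sum_congr rfl (g := fun _ => (γ i t ω : ℝ≥0∞))]
  · simp [sq]
  · intro ℓ hl
    exact Set.indicator_of_mem (s := {ω | ℓ ≤ γ i t ω}) (Finset.mem_range.1 hl).le _

/-!
The regret of a player is controlled by the mirror-descent identity `mwuStep_regret_eq`: against the
payoff vector that the update `π^{(t+1)}` uses, the regularized gain of a fixed strategy `p` over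
`π̄^{(t+1)}` telescopes in the relative entropy `KL(p ‖ π^{(t)})`. Two errors remain
(`regret_step_le`). The extrapolation `π̄^{(t+1)}` uses an older payoff vector than `π^{(t+1)}`,
which costs `η²` times a squared payoff difference. And the payoff vector that counts for the
regret is the one of `π̄^{(t+1)}`, not the delayed one. The comparator `p` is a maximizer and may
depend on all delays, so this second error is estimated realization by realization: by Pinsker's
inequality, the contraction `τ KL(p ‖ π^{(t)})` that comes from the regularization absorbs the
dependence on `p` and leaves the squared payoff difference divided by `τ`. What is gained is the
negative term `-KL(π̄^{(t+1)} ‖ π^{(t)})`, which dominates the quadratic variation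
`∑ₜ ‖π̄^{(t+1)} - π̄^{(t)}‖₁²` (`pathVariation_le`).

No equilibrium is needed to make use of this negative term. In a zero-sum polymatrix game the
regrets of all players add up to a nonnegative number, as one sees by comparing each player with the
time average of its own strategies (`sum_regret_nonneg`: the bilinear parts cancel, and the entropy
is concave). Hence the quadratic variation is at most the sum of the initial entropies `log |S_j|`
plus errors due to delays (`sum_pathVariation_le`).

These errors are in turn bounded by the quadratic variation, in expectation
(`integral_sum_staleError_le`). A delay `γ` in round `s` costs at most `γ` times the variation of
the last `γ` steps, by Cauchy–Schwarz. The step from `r` to `r + 1` depends only on delays of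
iterations up to `r < s`, so it is independent of the delay of round `s`, and it is charged
`𝔼[γ 𝟙{γ ≥ s - r}] ≤ E (s - r)`; over all `s` these charges sum to at most `σ²`. With the given step
size the errors are absorbed, the expected variation is at most `8 ∑ⱼ log |S_j|`, and substituting
this into the bound for a single player
(`mul_regret_le_staleError_add_pathVariation`) gives the theorem.
-/

/-! ### Relative entropy on finite alphabets -/

/-- The relative entropy `∑ₖ p k log (p k / q k)` of two real vectors, written with a difference of
logarithms. It is used for `q` with positive entries only; entries `p k = 0` contribute `0`. -/
noncomputable def relEntropy {α : Type*} [Fintype α] (p q : α → ℝ) : ℝ :=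
  ∑ k, p k * (Real.log (p k) - Real.log (q k))

/-- The `ℓ¹` distance of two real vectors. -/
def l1Dist {α : Type*} [Fintype α] (p q : α → ℝ) : ℝ := ∑ k, |p k - q k|

section Vectors

variable {α : Type*} [Fintype α]

theorem l1Dist_nonneg (p q : α → ℝ) : 0 ≤ l1Dist p q :=
  Finset.sum_nonneg fun _ _ => abs_nonneg _

theorem l1Dist_self (p : α → ℝ) : l1Dist p p = 0 := by simp [l1Dist]

theorem l1Dist_comm (p q : α → ℝ) : l1Dist p q = l1Dist q p := by
  simp only [l1Dist, abs_sub_comm]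

theorem l1Dist_triangle (p q r : α → ℝ) : l1Dist p r ≤ l1Dist p q + l1Dist q r := by
  unfold l1Dist
  rw [← Finset.sum_add_distrib]
  exact Finset.sum_le_sum fun k _ => abs_sub_le _ _ _

theorem l1Dist_le_two {p q : α → ℝ} (hp : p ∈ stdSimplex ℝ α) (hq : q ∈ stdSimplex ℝ α) :
    l1Dist p q ≤ 2 := by
  calc l1Dist p q ≤ ∑ k, (p k + q k) := Finset.sum_le_sum fun k _ => by
        rw [abs_le]; constructor <;> linarith [hp.1 k, hq.1 k]
    _ = 2 := by rw [Finset.sum_add_distrib, hp.2, hq.2]; norm_num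

theorem abs_sum_sub_mul_le (p q g : α → ℝ) {M : ℝ} (hg : ∀ k, |g k| ≤ M) :
    |∑ k, (p k - q k) * g k| ≤ l1Dist p q * M := by
  rw [l1Dist, Finset.sum_mul]
  refine (Finset.abs_sum_le_sum_abs _ _).trans (Finset.sum_le_sum fun k _ => ?_)
  rw [abs_mul]
  exact mul_le_mul_of_nonneg_left (hg k) (abs_nonneg _)

/-- The scalar inequality behind Pinsker's inequality. The difference of the two sides vanishes at
`1`, and its derivative `4 * ((x + 1) log x - 2 (x - 1))` has the sign of `x - 1`. -/
theorem three_mul_sq_le_mul_klFun {x : ℝ} (hx : 0 ≤ x) :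
    3 * (x - 1) ^ 2 ≤ (4 + 2 * x) * InformationTheory.klFun x := by
  set φ : ℝ → ℝ := fun x => (4 + 2 * x) * InformationTheory.klFun x - 3 * (x - 1) ^ 2 with hφ
  have hc : Continuous φ := by
    have := InformationTheory.continuous_klFun
    fun_prop
  have hd : ∀ y, 0 < y → HasDerivAt φ (4 * ((y + 1) * Real.log y - 2 * (y - 1))) y := by
    intro y hy
    have h1 := InformationTheory.hasDerivAt_klFun hy.ne'
    have h2 : HasDerivAt (fun x : ℝ => 4 + 2 * x) 2 y := by
      simpa using ((hasDerivAt_id y).const_mul 2).const_add 4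
    have h3 : HasDerivAt (fun x : ℝ => 3 * (x - 1) ^ 2) (6 * (y - 1)) y := by
      have := (((hasDerivAt_id y).sub_const 1).pow 2).const_mul 3
      refine this.congr_deriv ?_
      simp; ring
    refine ((h2.mul h1).sub h3).congr_deriv ?_
    rw [InformationTheory.klFun_apply]; ring
  have hlog : ∀ y, 1 ≤ y → 2 * (y - 1) ≤ (y + 1) * Real.log y := by
    intro y hy
    have h := Real.le_log_one_add_of_nonneg (x := y - 1) (by linarith)
    rw [show (1 : ℝ) + (y - 1) = y by ring, div_le_iff₀ (by linarith)] at h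
    linarith
  have hφ1 : φ 1 = 0 := by simp [hφ, InformationTheory.klFun_one]
  suffices h : 0 ≤ φ x by simp only [hφ] at h; linarith
  rcases le_total 1 x with h1 | h1
  · have hm : MonotoneOn φ (Set.Ici 1) := by
      refine monotoneOn_of_hasDerivWithinAt_nonneg (convex_Ici 1) hc.continuousOn
        (f' := fun y => 4 * ((y + 1) * Real.log y - 2 * (y - 1))) ?_ ?_
      · intro y hy
        rw [interior_Ici] at hy
        exact (hd y (lt_trans one_pos hy)).hasDerivWithinAt
      · intro y hy
        rw [interior_Ici] at hy
        have := hlog y hy.le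
        linarith
    simpa [hφ1] using hm (Set.mem_Ici.2 le_rfl) (Set.mem_Ici.2 h1) h1
  · have hm : AntitoneOn φ (Set.Icc 0 1) := by
      refine antitoneOn_of_hasDerivWithinAt_nonpos (convex_Icc 0 1) hc.continuousOn
        (f' := fun y => 4 * ((y + 1) * Real.log y - 2 * (y - 1))) ?_ ?_
      · intro y hy
        rw [interior_Icc] at hy
        exact (hd y hy.1).hasDerivWithinAt
      · intro y hy
        rw [interior_Icc] at hy
        have h := hlog y⁻¹ ((one_le_inv₀ hy.1).2 hy.2.le)
        rw [Real.log_inv] at h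
        have h' := mul_le_mul_of_nonneg_left h hy.1.le
        have e1 : y * (2 * (y⁻¹ - 1)) = 2 * (1 - y) := by
          have := hy.1.ne'; field_simp
        have e2 : y * ((y⁻¹ + 1) * -Real.log y) = -((y + 1) * Real.log y) := by
          have := hy.1.ne'; field_simp; ring
        rw [e1, e2] at h'
        linarith
    simpa [hφ1] using hm (Set.mem_Icc.2 ⟨hx, h1⟩) (Set.mem_Icc.2 ⟨zero_le_one, le_rfl⟩) h1

/-- Pinsker's inequality on a finite alphabet. -/
theorem l1Dist_sq_le_two_mul_relEntropy {p q : α → ℝ} (hp : p ∈ stdSimplex ℝ α)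
    (hq : q ∈ stdSimplex ℝ α) (hq0 : ∀ k, 0 < q k) :
    l1Dist p q ^ 2 ≤ 2 * relEntropy p q := by
  have hpt : ∀ k, |p k - q k| ^ 2 / (p k + 2 * q k) ≤
      2 / 3 * (p k * (Real.log (p k) - Real.log (q k)) + q k - p k) := by
    intro k
    have hqk := hq0 k
    have hpk := hp.1 k
    have h := three_mul_sq_le_mul_klFun (div_nonneg hpk hqk.le)
    have e : q k * InformationTheory.klFun (p k / q k) =
        p k * (Real.log (p k) - Real.log (q k)) + q k - p k := by
      rw [InformationTheory.klFun_apply]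
      rcases hpk.eq_or_lt with h0 | h0
      · simp [← h0]
      · rw [Real.log_div h0.ne' hqk.ne']; field_simp
    rw [div_le_iff₀ (by linarith), sq_abs, ← e]
    have h2 := mul_le_mul_of_nonneg_left h (sq_nonneg (q k))
    have e1 : q k ^ 2 * (3 * (p k / q k - 1) ^ 2) = 3 * (p k - q k) ^ 2 := by
      field_simp
    have e2 : q k ^ 2 * ((4 + 2 * (p k / q k)) * InformationTheory.klFun (p k / q k)) =
        (4 * q k + 2 * p k) * (q k * InformationTheory.klFun (p k / q k)) := by
      field_simp
    rw [e1, e2] at h2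
    linarith
  have hcs := Finset.sq_sum_div_le_sum_sq_div Finset.univ (fun k => |p k - q k|)
    (g := fun k => p k + 2 * q k) (fun k _ => by linarith [hp.1 k, hq0 k])
  have hs : ∑ k, (p k + 2 * q k) = 3 := by
    rw [Finset.sum_add_distrib, ← Finset.mul_sum, hp.2, hq.2]; norm_num
  have hr : ∑ k, 2 / 3 * (p k * (Real.log (p k) - Real.log (q k)) + q k - p k) =
      2 / 3 * relEntropy p q := by
    rw [← Finset.mul_sum, Finset.sum_sub_distrib, Finset.sum_add_distrib, hp.2, hq.2, relEntropy]
    ring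
  have := hcs.trans ((Finset.sum_le_sum fun k _ => hpt k).trans_eq hr)
  rw [hs] at this
  rw [l1Dist]
  linarith

theorem relEntropy_nonneg {p q : α → ℝ} (hp : p ∈ stdSimplex ℝ α)
    (hq : q ∈ stdSimplex ℝ α) (hq0 : ∀ k, 0 < q k) : 0 ≤ relEntropy p q := by
  nlinarith [l1Dist_sq_le_two_mul_relEntropy hp hq hq0, sq_nonneg (l1Dist p q)]

theorem mul_log_nonpos_of_mem_stdSimplex {p : α → ℝ} (hp : p ∈ stdSimplex ℝ α) (k : α) :
    p k * Real.log (p k) ≤ 0 :=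
  mul_nonpos_of_nonneg_of_nonpos (hp.1 k) (Real.log_nonpos (hp.1 k)
    (hp.2 ▸ Finset.single_le_sum (fun j _ => hp.1 j) (Finset.mem_univ k)))

theorem relEntropy_uniformVec_le {p : α → ℝ} (hp : p ∈ stdSimplex ℝ α) :
    relEntropy p (uniformVec α) ≤ Real.log (Fintype.card α) := by
  calc relEntropy p (uniformVec α) ≤ ∑ k, p k * Real.log (Fintype.card α) := by
        refine Finset.sum_le_sum fun k _ => ?_
        have := mul_log_nonpos_of_mem_stdSimplex hp k
        simp only [uniformVec, one_div, Real.log_inv, mul_sub]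
        linarith
    _ = _ := by rw [← Finset.sum_mul, hp.2, one_mul]

theorem uniformVec_pos [Nonempty α] (k : α) : 0 < uniformVec α k := by
  unfold uniformVec
  have : 0 < Fintype.card α := Fintype.card_pos
  positivity

theorem uniformVec_mem_stdSimplex [Nonempty α] : uniformVec α ∈ stdSimplex ℝ α := by
  refine ⟨fun k => (uniformVec_pos k).le, ?_⟩
  have : (Fintype.card α : ℝ) ≠ 0 := by exact_mod_cast Fintype.card_ne_zero
  simp [uniformVec, this]

/-! ### The multiplicative weights step -/

theorem mwuStep_denom_pos [Nonempty α] {η τ : ℝ} {x : α → ℝ} (hx : ∀ k, 0 < x k) (g : α → ℝ) :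
    0 < ∑ k, x k ^ (1 - η * τ) * Real.exp (η * g k) :=
  Finset.sum_pos (fun k _ => mul_pos (Real.rpow_pos_of_pos (hx k) _) (Real.exp_pos _))
    Finset.univ_nonempty

theorem mwuStep_pos [Nonempty α] {η τ : ℝ} {x : α → ℝ} (hx : ∀ k, 0 < x k) (g : α → ℝ) (k : α) :
    0 < mwuStep η τ x g k :=
  div_pos (mul_pos (Real.rpow_pos_of_pos (hx k) _) (Real.exp_pos _)) (mwuStep_denom_pos hx g)

theorem mwuStep_mem_stdSimplex [Nonempty α] {η τ : ℝ} {x : α → ℝ} (hx : ∀ k, 0 < x k)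
    (g : α → ℝ) : mwuStep η τ x g ∈ stdSimplex ℝ α := by
  refine ⟨fun k => (mwuStep_pos hx g k).le, ?_⟩
  simp only [mwuStep]
  rw [← Finset.sum_div, div_self (mwuStep_denom_pos hx g).ne']

theorem exists_log_mwuStep [Nonempty α] {η τ : ℝ} {x : α → ℝ} (hx : ∀ k, 0 < x k) (g : α → ℝ) :
    ∃ c, ∀ k, Real.log (mwuStep η τ x g k) = (1 - η * τ) * Real.log (x k) + η * g k - c := by
  refine ⟨Real.log (∑ k, x k ^ (1 - η * τ) * Real.exp (η * g k)), fun k => ?_⟩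
  have h1 := Real.rpow_pos_of_pos (hx k) (1 - η * τ)
  rw [mwuStep, Real.log_div (mul_pos h1 (Real.exp_pos _)).ne' (mwuStep_denom_pos hx g).ne',
    Real.log_mul h1.ne' (Real.exp_pos _).ne', Real.log_exp, Real.log_rpow (hx k)]

/-- The regularized mirror-descent identity: against the payoff vector used for the step, the gain
of `p` over `q` is a difference of relative entropies to the old and the new iterate. -/
theorem mwuStep_regret_eq [Nonempty α] {η τ : ℝ} {x : α → ℝ} (hx : ∀ k, 0 < x k) (g : α → ℝ)
    {p q : α → ℝ} (hp : p ∈ stdSimplex ℝ α) (hq : q ∈ stdSimplex ℝ α) :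
    η * (∑ k, (p k - q k) * g k) + η * τ * (shannonEntropy p - shannonEntropy q) =
      ((1 - η * τ) * relEntropy p x - relEntropy p (mwuStep η τ x g)) -
        ((1 - η * τ) * relEntropy q x - relEntropy q (mwuStep η τ x g)) := by
  obtain ⟨c, hc⟩ := exists_log_mwuStep (η := η) (τ := τ) hx g
  have key : ∀ r ∈ stdSimplex ℝ α, η * (∑ k, r k * g k) + η * τ * shannonEntropy r =
      ((1 - η * τ) * relEntropy r x - relEntropy r (mwuStep η τ x g)) + c := by
    intro r hr
    have : c = ∑ k, r k * c := by rw [← Finset.sum_mul, hr.2, one_mul]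
    rw [this]
    simp only [relEntropy, shannonEntropy, hc]
    rw [← Finset.sum_neg_distrib, Finset.mul_sum, Finset.mul_sum, Finset.mul_sum,
      ← Finset.sum_add_distrib, ← Finset.sum_sub_distrib, ← Finset.sum_add_distrib]
    refine Finset.sum_congr rfl fun k _ => ?_
    ring
  have h1 := key p hp
  have h2 := key q hq
  simp only [sub_mul, Finset.sum_sub_distrib]
  linarith

theorem relEntropy_add_relEntropy_mwuStep_le [Nonempty α] {η τ M : ℝ} (hη : 0 ≤ η) {x : α → ℝ}
    (hx : ∀ k, 0 < x k) {g h : α → ℝ} (hM : ∀ k, |g k - h k| ≤ M) :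
    relEntropy (mwuStep η τ x g) (mwuStep η τ x h) +
      relEntropy (mwuStep η τ x h) (mwuStep η τ x g) ≤
        η * (l1Dist (mwuStep η τ x g) (mwuStep η τ x h) * M) := by
  obtain ⟨c, hc⟩ := exists_log_mwuStep (η := η) (τ := τ) hx g
  obtain ⟨d, hd⟩ := exists_log_mwuStep (η := η) (τ := τ) hx h
  set p := mwuStep η τ x g with hpdef
  set q := mwuStep η τ x h with hqdef
  have hp : p ∈ stdSimplex ℝ α := mwuStep_mem_stdSimplex hx g
  have hq : q ∈ stdSimplex ℝ α := mwuStep_mem_stdSimplex hx h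
  have e : relEntropy p q + relEntropy q p = η * ∑ k, (p k - q k) * (g k - h k) := by
    have h0 : ∑ k, (p k - q k) * (d - c) = 0 := by
      rw [← Finset.sum_mul, Finset.sum_sub_distrib, hp.2, hq.2]; ring
    rw [← add_zero (η * _), ← h0]
    simp only [relEntropy, hc, hd]
    rw [Finset.mul_sum, ← Finset.sum_add_distrib, ← Finset.sum_add_distrib]
    refine Finset.sum_congr rfl fun k _ => ?_
    ring
  rw [e]
  exact mul_le_mul_of_nonneg_left
    ((le_abs_self _).trans (abs_sum_sub_mul_le p q (fun k => g k - h k) hM)) hη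

/-- The multiplicative weights step is `η`-Lipschitz in the payoff vector. -/
theorem l1Dist_mwuStep_le [Nonempty α] {η τ M : ℝ} (hη : 0 ≤ η) (hM0 : 0 ≤ M) {x : α → ℝ}
    (hx : ∀ k, 0 < x k) {g h : α → ℝ} (hM : ∀ k, |g k - h k| ≤ M) :
    l1Dist (mwuStep η τ x g) (mwuStep η τ x h) ≤ η * M := by
  have h1 := relEntropy_add_relEntropy_mwuStep_le (τ := τ) hη hx hM
  have h2 := l1Dist_sq_le_two_mul_relEntropy (mwuStep_mem_stdSimplex (η := η) (τ := τ) hx g)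
    (mwuStep_mem_stdSimplex (η := η) (τ := τ) hx h) (mwuStep_pos hx h)
  have h3 := l1Dist_sq_le_two_mul_relEntropy (mwuStep_mem_stdSimplex (η := η) (τ := τ) hx h)
    (mwuStep_mem_stdSimplex (η := η) (τ := τ) hx g) (mwuStep_pos hx g)
  rw [l1Dist_comm] at h3
  have h4 := l1Dist_nonneg (mwuStep η τ x g) (mwuStep η τ x h)
  have h5 := mul_nonneg hη hM0
  nlinarith

theorem relEntropy_mwuStep_le [Nonempty α] {η τ M : ℝ} (hη : 0 ≤ η) (hM0 : 0 ≤ M) {x : α → ℝ}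
    (hx : ∀ k, 0 < x k) {g h : α → ℝ} (hM : ∀ k, |g k - h k| ≤ M) :
    relEntropy (mwuStep η τ x g) (mwuStep η τ x h) ≤ η ^ 2 * M ^ 2 := by
  have h1 := relEntropy_add_relEntropy_mwuStep_le (τ := τ) hη hx hM
  have h2 := relEntropy_nonneg (mwuStep_mem_stdSimplex (η := η) (τ := τ) hx h)
    (mwuStep_mem_stdSimplex (η := η) (τ := τ) hx g) (mwuStep_pos hx g)
  have h3 := mul_le_mul_of_nonneg_left (l1Dist_mwuStep_le (τ := τ) hη hM0 hx hM)
    (mul_nonneg hη hM0)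
  nlinarith

/-- One round of regret of the extrapolated iterate `q`, which is built from the stale payoff
vector `g₀`, while `g₁` is the payoff vector of the next update and `g` the true one. The mismatch
between `g` and `g₁` is paid for by the regularization `τ`, so that `p` may be arbitrary. -/
theorem regret_step_le [Nonempty α] {η τ M D : ℝ} (hη : 0 ≤ η) (hτ : 0 < τ) (hM0 : 0 ≤ M)
    {x : α → ℝ} (hx : ∀ k, 0 < x k) (hx1 : x ∈ stdSimplex ℝ α) {g g₀ g₁ : α → ℝ}
    (hM : ∀ k, |g₀ k - g₁ k| ≤ M) (hD : ∀ k, |g k - g₁ k| ≤ D)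
    {p q : α → ℝ} (hp : p ∈ stdSimplex ℝ α) (hq : q = mwuStep η τ x g₀) :
    η * ((∑ k, (p k - q k) * g k) + τ * (shannonEntropy p - shannonEntropy q)) ≤
      relEntropy p x - relEntropy p (mwuStep η τ x g₁) - (1 - 2 * η * τ) * relEntropy q x +
        η ^ 2 * M ^ 2 + η * (D ^ 2 / τ) := by
  have hqs : q ∈ stdSimplex ℝ α := hq ▸ mwuStep_mem_stdSimplex hx g₀
  have h1 := mwuStep_regret_eq (η := η) (τ := τ) hx g₁ hp hqs
  have h2 : relEntropy q (mwuStep η τ x g₁) ≤ η ^ 2 * M ^ 2 := by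
    rw [hq]; exact relEntropy_mwuStep_le hη hM0 hx hM
  have h3 : ∑ k, (p k - q k) * (g k - g₁ k) ≤ l1Dist p q * D :=
    (le_abs_self _).trans (abs_sum_sub_mul_le p q (fun k => g k - g₁ k) hD)
  have h4 : l1Dist p q ≤ l1Dist p x + l1Dist q x := by
    rw [l1Dist_comm q x]; exact l1Dist_triangle _ _ _
  have hp2 := l1Dist_sq_le_two_mul_relEntropy hp hx1 hx
  have hq2 := l1Dist_sq_le_two_mul_relEntropy hqs hx1 hx
  have hD0 : 0 ≤ D := (abs_nonneg _).trans (hD (Classical.arbitrary α))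
  have young : ∀ y : ℝ, y * D ≤ τ / 2 * y ^ 2 + D ^ 2 / τ / 2 := by
    intro y
    have : 0 ≤ (τ * y - D) ^ 2 / (2 * τ) := by positivity
    have e : (τ * y - D) ^ 2 / (2 * τ) = τ / 2 * y ^ 2 + D ^ 2 / τ / 2 - y * D := by
      field_simp; ring
    linarith
  have h5 : ∑ k, (p k - q k) * (g k - g₁ k) ≤
      τ * relEntropy p x + τ * relEntropy q x + D ^ 2 / τ := by
    have y1 := young (l1Dist p x)
    have y2 := young (l1Dist q x)
    have := mul_le_mul_of_nonneg_right h4 hD0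
    nlinarith
  have h6 := mul_le_mul_of_nonneg_left h5 hη
  have e : ∑ k, (p k - q k) * (g k - g₁ k) =
      ∑ k, (p k - q k) * g k - ∑ k, (p k - q k) * g₁ k := by
    rw [← Finset.sum_sub_distrib]; exact Finset.sum_congr rfl fun k _ => by ring
  rw [e] at h6
  nlinarith

end Vectors

/-! ### Payoffs of a polymatrix game -/

namespace PolymatrixGame

theorem maxPayoff_nonneg {V : Type*} {S : V → Type*} (G : PolymatrixGame V S) : 0 ≤ G.maxPayoff :=
  Real.iSup_nonneg fun _ => Real.iSup_nonneg fun _ => Real.iSup_nonneg fun _ =>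
    Real.iSup_nonneg fun _ => abs_nonneg _

theorem A_self {V : Type*} {S : V → Type*} (G : PolymatrixGame V S) (i : V) : G.A i i = 0 :=
  G.A_eq_zero i i (G.graph.irrefl)

open Classical in
theorem sum_sum_neighborFinset_le {V : Type*} {S : V → Type*} [Fintype V]
    (G : PolymatrixGame V S) {f : V → ℝ} (hf : ∀ j, 0 ≤ f j) :
    ∑ i, ∑ j ∈ G.graph.neighborFinset i, f j ≤ G.dmax * ∑ j, f j := by
  rw [Finset.sum_comm' (t' := Finset.univ) (s' := fun j => G.graph.neighborFinset j)
    (by intro i j; simp [G.graph.adj_comm]), Finset.mul_sum]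
  refine Finset.sum_le_sum fun j _ => ?_
  rw [Finset.sum_const, nsmul_eq_mul, SimpleGraph.card_neighborFinset_eq_degree]
  exact mul_le_mul_of_nonneg_right (by exact_mod_cast G.graph.degree_le_maxDegree j) (hf j)

variable {V : Type*} {S : V → Type*} [Fintype V] [∀ i, Fintype (S i)]

theorem abs_le_maxPayoff (G : PolymatrixGame V S) (i j : V) (s : S i) (s' : S j) :
    |G.A i j s s'| ≤ G.maxPayoff := by
  unfold maxPayoff
  refine le_ciSup_of_le (Set.finite_range _).bddAbove i ?_
  refine le_ciSup_of_le (Set.finite_range _).bddAbove j ?_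
  refine le_ciSup_of_le (Set.finite_range _).bddAbove s ?_
  exact le_ciSup (f := fun s' => |G.A i j s s'|) (Set.finite_range _).bddAbove s'

theorem payoffVec_apply (G : PolymatrixGame V S) (i : V) (x : StrategyProfile S) (k : S i) :
    G.payoffVec i x k = ∑ j, ∑ k', G.A i j k k' * x j k' := by
  simp [payoffVec, Matrix.mulVec, dotProduct, Finset.sum_apply]

theorem payoffVec_update_self [DecidableEq V] (G : PolymatrixGame V S) (i : V)
    (x : StrategyProfile S) (p : S i → ℝ) :
    G.payoffVec i (Function.update x i p) = G.payoffVec i x := by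
  unfold payoffVec
  refine Finset.sum_congr rfl fun j _ => ?_
  by_cases h : j = i
  · subst h; simp [A_self]
  · rw [Function.update_of_ne h]

theorem utility_eq_sum (G : PolymatrixGame V S) (i : V) (x : StrategyProfile S) :
    G.utility i x = ∑ k, x i k * G.payoffVec i x k := rfl

theorem regUtility_update [DecidableEq V] (G : PolymatrixGame V S) (τ : ℝ) (i : V)
    (x : StrategyProfile S) (p : S i → ℝ) :
    G.regUtility τ i (Function.update x i p) =
      ∑ k, p k * G.payoffVec i x k + τ * shannonEntropy p := by
  rw [regUtility, utility_eq_sum, payoffVec_update_self, Function.update_self]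

/-- Regularized utilities are bounded, by continuity on the compact set of mixed profiles. -/
theorem exists_abs_regUtility_le (G : PolymatrixGame V S) (τ : ℝ) (i : V) :
    ∃ C, ∀ x : StrategyProfile S, (∀ j, x j ∈ stdSimplex ℝ (S j)) → |G.regUtility τ i x| ≤ C := by
  have hK : IsCompact (Set.univ.pi fun j => stdSimplex ℝ (S j)) :=
    isCompact_univ_pi fun j => isCompact_stdSimplex ℝ (S j)
  have hc : Continuous (G.regUtility τ i) := by
    unfold regUtility shannonEntropy
    simp only [utility_eq_sum, payoffVec_apply]
    refine Continuous.add (by fun_prop) (continuous_const.mul (Continuous.neg ?_))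
    exact continuous_finsetSum _ fun k _ => Real.continuous_mul_log.comp (by fun_prop)
  obtain ⟨C, hC⟩ := hK.exists_bound_of_continuousOn hc.continuousOn
  exact ⟨C, fun x hx => hC x fun j _ => hx j⟩

open Classical in
/-- The bound `‖A‖_∞ ∑_{j ∼ i} ‖x_j - y_j‖₁` on the distance of the payoff vectors of player `i`
under two profiles, the sum being over the neighbours of `i`. -/
noncomputable def payoffGap (G : PolymatrixGame V S) (i : V) (x y : StrategyProfile S) : ℝ :=
  G.maxPayoff * ∑ j ∈ G.graph.neighborFinset i, l1Dist (x j) (y j)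

theorem payoffGap_nonneg (G : PolymatrixGame V S) (i : V) (x y : StrategyProfile S) :
    0 ≤ G.payoffGap i x y :=
  mul_nonneg G.maxPayoff_nonneg (Finset.sum_nonneg fun _ _ => l1Dist_nonneg _ _)

theorem payoffGap_self (G : PolymatrixGame V S) (i : V) (x : StrategyProfile S) :
    G.payoffGap i x x = 0 := by
  simp [payoffGap, l1Dist_self]

theorem payoffGap_comm (G : PolymatrixGame V S) (i : V) (x y : StrategyProfile S) :
    G.payoffGap i x y = G.payoffGap i y x := by
  unfold payoffGap
  simp only [l1Dist_comm]

theorem payoffGap_triangle (G : PolymatrixGame V S) (i : V) (x y z : StrategyProfile S) :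
    G.payoffGap i x z ≤ G.payoffGap i x y + G.payoffGap i y z := by
  unfold payoffGap
  rw [← mul_add, ← Finset.sum_add_distrib]
  exact mul_le_mul_of_nonneg_left
    (Finset.sum_le_sum fun j _ => l1Dist_triangle _ _ _) G.maxPayoff_nonneg

theorem abs_payoffVec_sub_le (G : PolymatrixGame V S) (i : V) (x y : StrategyProfile S) (k : S i) :
    |G.payoffVec i x k - G.payoffVec i y k| ≤ G.payoffGap i x y := by
  classical
  have e : G.payoffVec i x k - G.payoffVec i y k =
      ∑ j ∈ G.graph.neighborFinset i, ∑ k', (x j k' - y j k') * G.A i j k k' := by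
    rw [payoffVec_apply, payoffVec_apply, ← Finset.sum_sub_distrib]
    rw [← Finset.sum_subset (Finset.subset_univ (G.graph.neighborFinset i))]
    · refine Finset.sum_congr rfl fun j _ => ?_
      rw [← Finset.sum_sub_distrib]
      exact Finset.sum_congr rfl fun k' _ => by ring
    · intro j _ hj
      rw [SimpleGraph.mem_neighborFinset] at hj
      simp [G.A_eq_zero i j hj]
  rw [e, payoffGap, Finset.mul_sum]
  refine (Finset.abs_sum_le_sum_abs _ _).trans ?_
  convert Finset.sum_le_sum fun j (_ : j ∈ G.graph.neighborFinset i) =>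
    (abs_sum_sub_mul_le (x j) (y j) (fun k' => G.A i j k k')
      (fun k' => G.abs_le_maxPayoff i j k k')).trans_eq (mul_comm _ _)

open Classical in
theorem payoffGap_sq_le (G : PolymatrixGame V S) (i : V) (x y : StrategyProfile S) :
    G.payoffGap i x y ^ 2 ≤ G.maxPayoff ^ 2 *
      (G.dmax * ∑ j ∈ G.graph.neighborFinset i, l1Dist (x j) (y j) ^ 2) := by
  rw [payoffGap, mul_pow]
  refine mul_le_mul_of_nonneg_left ?_ (sq_nonneg _)
  refine sq_sum_le_card_mul_sum_sq.trans ?_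
  refine mul_le_mul_of_nonneg_right ?_ (Finset.sum_nonneg fun _ _ => sq_nonneg _)
  rw [SimpleGraph.card_neighborFinset_eq_degree]
  exact_mod_cast G.graph.degree_le_maxDegree i

theorem sum_payoffGap_sq_le (G : PolymatrixGame V S) (x y : StrategyProfile S) :
    ∑ i, G.payoffGap i x y ^ 2 ≤
      (G.dmax * G.maxPayoff) ^ 2 * ∑ j, l1Dist (x j) (y j) ^ 2 := by
  classical
  calc ∑ i, G.payoffGap i x y ^ 2
      ≤ ∑ i, G.maxPayoff ^ 2 *
          (G.dmax * ∑ j ∈ G.graph.neighborFinset i, l1Dist (x j) (y j) ^ 2) :=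
        Finset.sum_le_sum fun i _ => by convert G.payoffGap_sq_le i x y
    _ = G.maxPayoff ^ 2 *
          (G.dmax * ∑ i, ∑ j ∈ G.graph.neighborFinset i, l1Dist (x j) (y j) ^ 2) := by
        rw [Finset.mul_sum, Finset.mul_sum]
    _ ≤ G.maxPayoff ^ 2 * (G.dmax * (G.dmax * ∑ j, l1Dist (x j) (y j) ^ 2)) := by
        gcongr
        convert G.sum_sum_neighborFinset_le fun j => sq_nonneg (l1Dist (x j) (y j))
    _ = _ := by ring

/-! ### Zero-sum games -/

/-- The total utility is affine in the strategy of each player, as no player plays against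
itself. -/
theorem exists_sum_utility_update_eq [DecidableEq V] (G : PolymatrixGame V S)
    (x : StrategyProfile S) (l : V) :
    ∃ (c : S l → ℝ) (C : ℝ), ∀ p : S l → ℝ,
      ∑ i, G.utility i (Function.update x l p) = ∑ a, p a * c a + C := by
  have h : ∀ i, ∃ (c : S l → ℝ) (C : ℝ), ∀ p : S l → ℝ,
      G.utility i (Function.update x l p) = ∑ a, p a * c a + C := by
    intro i
    by_cases hil : i = l
    · subst hil
      refine ⟨G.payoffVec i x, 0, fun p => ?_⟩
      rw [utility_eq_sum, payoffVec_update_self, Function.update_self, add_zero]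
    · refine ⟨fun a => ∑ k, x i k * G.A i l k a,
        ∑ k, x i k * ∑ j ∈ Finset.univ.erase l, ∑ k', G.A i j k k' * x j k', fun p => ?_⟩
      have e : ∀ k, G.payoffVec i (Function.update x l p) k =
          ∑ a, G.A i l k a * p a +
            ∑ j ∈ Finset.univ.erase l, ∑ k', G.A i j k k' * x j k' := by
        intro k
        rw [payoffVec_apply, ← Finset.add_sum_erase _ _ (Finset.mem_univ l),
          Function.update_self]
        congr 1
        refine Finset.sum_congr rfl fun j hj => ?_
        rw [Function.update_of_ne (Finset.ne_of_mem_erase hj)]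
      rw [utility_eq_sum, Function.update_of_ne hil]
      simp only [e, mul_add, Finset.sum_add_distrib]
      congr 1
      simp only [Finset.mul_sum]
      rw [Finset.sum_comm]
      exact Finset.sum_congr rfl fun a _ => Finset.sum_congr rfl fun k _ => by ring
  choose c C hc using h
  refine ⟨fun a => ∑ i, c i a, ∑ i, C i, fun p => ?_⟩
  simp only [hc, Finset.sum_add_distrib, Finset.mul_sum]
  rw [Finset.sum_comm]

/-- The zero-sum condition extends from pure to mixed profiles. -/
theorem IsZeroSum.sum_utility_eq_zero {G : PolymatrixGame V S} (hG : G.IsZeroSum)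
    {x : StrategyProfile S} (hx : ∀ i, x i ∈ stdSimplex ℝ (S i)) :
    ∑ i, G.utility i x = 0 := by
  classical
  -- The players outside `s` play pure strategies; `s` grows one player at a time.
  have key : ∀ (s : Finset V) (x : StrategyProfile S), (∀ i ∈ s, x i ∈ stdSimplex ℝ (S i)) →
      (∀ i ∉ s, ∃ a : S i, x i = Pi.single a 1) → ∑ i, G.utility i x = 0 := by
    intro s
    induction s using Finset.induction_on with
    | empty =>
      intro x _ hx
      choose a ha using fun i => hx i (Finset.notMem_empty i)
      rw [← hG a]
      refine Finset.sum_congr rfl fun i _ => ?_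
      rw [utility_eq_sum, pureUtility, ha i, Finset.sum_eq_single (a i)]
      · rw [Pi.single_eq_same, one_mul, payoffVec_apply]
        refine Finset.sum_congr rfl fun j _ => ?_
        rw [ha j, Finset.sum_eq_single (a j)]
        · simp
        · intro b _ hb; simp [hb]
        · simp
      · intro b _ hb; simp [hb]
      · simp
    | insert l s hl ih =>
      intro x hx1 hx2
      obtain ⟨c, C, hc⟩ := G.exists_sum_utility_update_eq x l
      have hv : ∀ a, c a + C = 0 := by
        intro a
        have h1 := hc (Pi.single a 1)
        rw [Finset.sum_eq_single a (by intro b _ hb; simp [hb]) (by simp), Pi.single_eq_same,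
          one_mul] at h1
        rw [← h1]
        refine ih _ (fun i hi => ?_) (fun i hi => ?_)
        · rw [Function.update_of_ne (by rintro rfl; exact hl hi)]
          exact hx1 i (Finset.mem_insert_of_mem hi)
        · by_cases hil : i = l
          · subst hil
            exact ⟨a, Function.update_self ..⟩
          · rw [Function.update_of_ne hil]
            exact hx2 i (by simp [hil, hi])
      have h2 := hc (x l)
      rw [Function.update_eq_self] at h2
      have hxl := (hx1 l (Finset.mem_insert_self l s)).2
      rw [h2, Finset.sum_congr rfl fun a _ => by rw [eq_neg_of_add_eq_zero_left (hv a)],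
        ← Finset.sum_mul, hxl]
      ring
  exact key Finset.univ x (fun i _ => hx i) (fun i hi => absurd (Finset.mem_univ i) hi)

/-- Jensen's inequality for the entropy of a time average. -/
theorem sum_shannonEntropy_le {α : Type*} [Fintype α] {T : ℕ} (hT : 1 ≤ T)
    {y : ℕ → α → ℝ} (hy : ∀ t, y t ∈ stdSimplex ℝ α) :
    ∑ t ∈ Finset.Icc 1 T, shannonEntropy (y t) ≤
      T * shannonEntropy (fun k => ∑ t ∈ Finset.Icc 1 T, (1 / (T : ℝ)) * y t k) := by
  have hT0 : (0 : ℝ) < T := by exact_mod_cast hT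
  simp only [shannonEntropy, Finset.sum_neg_distrib, mul_neg]
  rw [neg_le_neg_iff, Finset.sum_comm, Finset.mul_sum]
  refine Finset.sum_le_sum fun k _ => ?_
  have h := Real.convexOn_mul_log.map_sum_le (t := Finset.Icc 1 T) (w := fun _ => 1 / (T : ℝ))
    (p := fun t => y t k) (fun _ _ => by positivity) (by simp [hT0.ne'])
    (fun t _ => (hy t).1 k)
  simp only [smul_eq_mul] at h
  have h2 := mul_le_mul_of_nonneg_left h hT0.le
  rw [← Finset.mul_sum (Finset.Icc 1 T) (fun t => y t k * Real.log (y t k)), one_div,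
    mul_inv_cancel_left₀ hT0.ne'] at h2
  simpa only [one_div] using h2

/-- In a zero-sum game the regrets of all players add up to a nonnegative number: compare each
player with the time average of its own strategies. -/
theorem sum_regret_nonneg [DecidableEq V] [∀ i, Nonempty (S i)] {G : PolymatrixGame V S}
    (hG : G.IsZeroSum) {τ : ℝ} (hτ : 0 ≤ τ) {x : ℕ → StrategyProfile S}
    (hx : ∀ t i, x t i ∈ stdSimplex ℝ (S i)) {T : ℕ} (hT : 1 ≤ T) :
    0 ≤ ∑ i, G.regret τ x i T := by
  have hT0 : (0 : ℝ) < T := by exact_mod_cast hT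
  set p : StrategyProfile S := fun i k => ∑ t ∈ Finset.Icc 1 T, (1 / (T : ℝ)) * x t i k with hp
  have hps : ∀ i, p i ∈ stdSimplex ℝ (S i) := by
    intro i
    have := (convex_stdSimplex ℝ (S i)).sum_mem (t := Finset.Icc 1 T)
      (w := fun _ => 1 / (T : ℝ)) (z := fun t => x t i) (fun _ _ => by positivity)
      (by simp [hT0.ne']) (fun t _ => hx t i)
    convert this using 1
    ext k
    simp [hp, Finset.sum_apply]
  have hlow : ∀ i, ∑ t ∈ Finset.Icc 1 T, ∑ k, p i k * G.payoffVec i (x t) k +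
      T * (τ * shannonEntropy (p i)) - (∑ t ∈ Finset.Icc 1 T, G.utility i (x t) +
        τ * ∑ t ∈ Finset.Icc 1 T, shannonEntropy (x t i)) ≤ G.regret τ x i T := by
    intro i
    have h := (G.isGreatest_fixedStrategyUtility τ x i T).2 ⟨p i, hps i, rfl⟩
    have e : G.fixedStrategyUtility τ x i T (p i) =
        ∑ t ∈ Finset.Icc 1 T, ∑ k, p i k * G.payoffVec i (x t) k +
          T * (τ * shannonEntropy (p i)) := by
      simp only [fixedStrategyUtility, regUtility_update, Finset.sum_add_distrib]
      simp
    rw [e] at h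
    simp only [regret, regUtility, Finset.sum_add_distrib, Finset.mul_sum (s := Finset.Icc 1 T)]
    linarith
  have hpay : ∀ i, ∑ t ∈ Finset.Icc 1 T, ∑ k, p i k * G.payoffVec i (x t) k =
      T * G.utility i p := by
    intro i
    have hv : ∀ k, ∑ t ∈ Finset.Icc 1 T, G.payoffVec i (x t) k = T * G.payoffVec i p k := by
      intro k
      simp only [payoffVec_apply, hp, ← Finset.mul_sum]
      rw [Finset.sum_comm, Finset.mul_sum]
      refine Finset.sum_congr rfl fun j _ => ?_
      rw [Finset.sum_comm, Finset.mul_sum]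
      refine Finset.sum_congr rfl fun k' _ => ?_
      rw [← Finset.mul_sum]
      field_simp
    rw [Finset.sum_comm, utility_eq_sum, Finset.mul_sum]
    refine Finset.sum_congr rfl fun k _ => ?_
    rw [← Finset.mul_sum, hv]; ring
  have hent : ∀ i, ∑ t ∈ Finset.Icc 1 T, shannonEntropy (x t i) ≤ T * shannonEntropy (p i) :=
    fun i => sum_shannonEntropy_le hT fun t => hx t i
  have h1 : ∑ i, (T * G.utility i p - ∑ t ∈ Finset.Icc 1 T, G.utility i (x t)) = 0 := by
    rw [Finset.sum_sub_distrib, ← Finset.mul_sum, hG.sum_utility_eq_zero hps, Finset.sum_comm,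
      Finset.sum_eq_zero fun t _ => hG.sum_utility_eq_zero (hx t)]
    ring
  rw [← h1]
  refine Finset.sum_le_sum fun i _ => (hlow i).trans' ?_
  rw [hpay i]
  nlinarith [mul_le_mul_of_nonneg_left (hent i) hτ]

/-! ### The iterates of OMWU -/

theorem omwu_zero (G : PolymatrixGame V S) (η τ : ℝ) (γ : V → ℕ → ℕ) (i : V) :
    G.omwu η τ γ 0 i = uniformVec (S i) := by rw [omwu]

theorem omwuBar_zero (G : PolymatrixGame V S) (η τ : ℝ) (γ : V → ℕ → ℕ) (i : V) :
    G.omwuBar η τ γ 0 i = uniformVec (S i) := by rw [omwuBar]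

theorem omwu_succ (G : PolymatrixGame V S) (η τ : ℝ) (γ : V → ℕ → ℕ) (t : ℕ) (i : V) :
    G.omwu η τ γ (t + 1) i = mwuStep η τ (G.omwu η τ γ t i)
      (G.payoffVec i (G.omwuBar η τ γ (t + 1 - γ i (t + 1)))) := by rw [omwu]

theorem omwuBar_succ (G : PolymatrixGame V S) (η τ : ℝ) (γ : V → ℕ → ℕ) (t : ℕ) (i : V) :
    G.omwuBar η τ γ (t + 1) i = mwuStep η τ (G.omwu η τ γ t i)
      (G.payoffVec i (G.omwuBar η τ γ (t - γ i t))) := by rw [omwuBar]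

/-- The iterates up to time `t` depend only on the delays of the iterations before `t`, and for
`omwu` also on those of iteration `t` itself. -/
theorem omwu_congr (G : PolymatrixGame V S) (η τ : ℝ) (t : ℕ) (γ γ' : V → ℕ → ℕ)
    (h : ∀ i, ∀ u < t, γ i u = γ' i u) :
    (∀ s ≤ t, G.omwuBar η τ γ s = G.omwuBar η τ γ' s) ∧
      ∀ s < t, G.omwu η τ γ s = G.omwu η τ γ' s := by
  induction t with
  | zero =>
    refine ⟨fun s hs => ?_, fun s hs => absurd hs (Nat.not_lt_zero s)⟩
    obtain rfl := Nat.le_zero.1 hs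
    funext i
    rw [omwuBar_zero, omwuBar_zero]
  | succ t ih =>
    obtain ⟨ih1, ih2⟩ := ih fun i u hu => h i u (hu.trans t.lt_succ_self)
    have h2 : ∀ s < t + 1, G.omwu η τ γ s = G.omwu η τ γ' s := by
      intro s hs
      rcases Nat.lt_succ_iff_lt_or_eq.1 hs with hs | rfl
      · exact ih2 s hs
      funext i
      cases s with
      | zero => rw [omwu_zero, omwu_zero]
      | succ s =>
        rw [omwu_succ, omwu_succ, ih2 s s.lt_succ_self, h i (s + 1) hs, ih1 _ (Nat.sub_le _ _)]
    refine ⟨fun s hs => ?_, h2⟩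
    rcases Nat.le_succ_iff.1 hs with hs | rfl
    · exact ih1 s hs
    funext i
    rw [omwuBar_succ, omwuBar_succ, h2 t t.lt_succ_self, h i t t.lt_succ_self,
      ih1 _ (Nat.sub_le _ _)]

section Iterates

variable [∀ i, Nonempty (S i)]

theorem omwu_pos (G : PolymatrixGame V S) (η τ : ℝ) (γ : V → ℕ → ℕ) (t : ℕ) (i : V) (k : S i) :
    0 < G.omwu η τ γ t i k := by
  induction t generalizing k with
  | zero => rw [omwu_zero]; exact uniformVec_pos k
  | succ t ih => rw [omwu_succ]; exact mwuStep_pos ih _ k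

theorem omwu_mem_stdSimplex (G : PolymatrixGame V S) (η τ : ℝ) (γ : V → ℕ → ℕ) (t : ℕ) (i : V) :
    G.omwu η τ γ t i ∈ stdSimplex ℝ (S i) := by
  cases t with
  | zero => rw [omwu_zero]; exact uniformVec_mem_stdSimplex
  | succ t => rw [omwu_succ]; exact mwuStep_mem_stdSimplex (G.omwu_pos η τ γ t i) _

theorem omwuBar_mem_stdSimplex (G : PolymatrixGame V S) (η τ : ℝ) (γ : V → ℕ → ℕ) (t : ℕ)
    (i : V) : G.omwuBar η τ γ t i ∈ stdSimplex ℝ (S i) := by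
  cases t with
  | zero => rw [omwuBar_zero]; exact uniformVec_mem_stdSimplex
  | succ t => rw [omwuBar_succ]; exact mwuStep_mem_stdSimplex (G.omwu_pos η τ γ t i) _

end Iterates

end PolymatrixGame

/-! ### Regret bounds along a fixed realization of the delays -/

theorem sum_range_le_sum_range_of_shift {f g : ℕ → ℝ} (hf : ∀ t, 0 ≤ f t) (h0 : g 0 ≤ 0)
    (h : ∀ t, g (t + 1) ≤ f t) (T : ℕ) : ∑ t ∈ Finset.range T, g t ≤ ∑ t ∈ Finset.range T, f t := by
  cases T with
  | zero => simp
  | succ T =>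
    rw [Finset.sum_range_succ', Finset.sum_range_succ]
    have := Finset.sum_le_sum fun t (_ : t ∈ Finset.range T) => h t
    linarith [hf T]

theorem sum_Icc_one_eq_sum_range (f : ℕ → ℝ) (T : ℕ) :
    ∑ t ∈ Finset.Icc 1 T, f t = ∑ t ∈ Finset.range T, f (t + 1) := by
  induction T with
  | zero => simp
  | succ T ih => rw [Finset.sum_Icc_succ_top (by omega), ih, Finset.sum_range_succ]

namespace PolymatrixGame

variable {V : Type*} {S : V → Type*} [Fintype V] [∀ i, Fintype (S i)]

/-- The accumulated squared error of player `i` from playing against delayed payoffs: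
`∑ₜ gap_i(π̄^{(t)}, π̄^{(κ_i^{(t)})})²` over the rounds `1, …, T`. -/
noncomputable def staleError (G : PolymatrixGame V S) (η τ : ℝ) (γ : V → ℕ → ℕ) (T : ℕ) (i : V) :
    ℝ :=
  ∑ t ∈ Finset.range T, G.payoffGap i (G.omwuBar η τ γ (t + 1))
    (G.omwuBar η τ γ (t + 1 - γ i (t + 1))) ^ 2

/-- The accumulated squared differences of the payoffs that player `i` sees in consecutive
iterations. -/
noncomputable def payoffJump (G : PolymatrixGame V S) (η τ : ℝ) (γ : V → ℕ → ℕ) (T : ℕ) (i : V) :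
    ℝ :=
  ∑ t ∈ Finset.range T, G.payoffGap i (G.omwuBar η τ γ (t - γ i t))
    (G.omwuBar η τ γ (t + 1 - γ i (t + 1))) ^ 2

/-- The quadratic variation `∑ₜ ‖π̄_i^{(t+1)} - π̄_i^{(t)}‖₁²` of the strategies of player `i`. -/
noncomputable def pathVariation (G : PolymatrixGame V S) (η τ : ℝ) (γ : V → ℕ → ℕ) (T : ℕ)
    (i : V) : ℝ :=
  ∑ t ∈ Finset.range T, l1Dist (G.omwuBar η τ γ (t + 1) i) (G.omwuBar η τ γ t i) ^ 2

/-- The accumulated relative entropy of the extrapolated iterates of player `i` with respect to the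
iterates that they extrapolate. -/
noncomputable def extrapolationEntropy (G : PolymatrixGame V S) (η τ : ℝ) (γ : V → ℕ → ℕ) (T : ℕ)
    (i : V) : ℝ :=
  ∑ t ∈ Finset.range T, relEntropy (G.omwuBar η τ γ (t + 1) i) (G.omwu η τ γ t i)

theorem staleError_nonneg (G : PolymatrixGame V S) (η τ : ℝ) (γ : V → ℕ → ℕ) (T : ℕ) (i : V) :
    0 ≤ G.staleError η τ γ T i :=
  Finset.sum_nonneg fun _ _ => sq_nonneg _

theorem payoffJump_nonneg (G : PolymatrixGame V S) (η τ : ℝ) (γ : V → ℕ → ℕ) (T : ℕ) (i : V) :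
    0 ≤ G.payoffJump η τ γ T i :=
  Finset.sum_nonneg fun _ _ => sq_nonneg _

theorem pathVariation_nonneg (G : PolymatrixGame V S) (η τ : ℝ) (γ : V → ℕ → ℕ) (T : ℕ) (i : V) :
    0 ≤ G.pathVariation η τ γ T i :=
  Finset.sum_nonneg fun _ _ => sq_nonneg _

theorem sum_payoffJump_le (G : PolymatrixGame V S) (η τ : ℝ) (γ : V → ℕ → ℕ) (T : ℕ) :
    ∑ i, G.payoffJump η τ γ T i ≤ 6 * ∑ i, G.staleError η τ γ T i +
      3 * ((G.dmax * G.maxPayoff) ^ 2 * ∑ i, G.pathVariation η τ γ T i) := by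
  set y := G.omwuBar η τ γ with hy
  have h1 : ∀ i, G.payoffJump η τ γ T i ≤ 6 * G.staleError η τ γ T i +
      3 * ∑ t ∈ Finset.range T, G.payoffGap i (y (t + 1)) (y t) ^ 2 := by
    intro i
    have hpt : ∀ t, G.payoffGap i (y (t - γ i t)) (y (t + 1 - γ i (t + 1))) ^ 2 ≤
        3 * G.payoffGap i (y t) (y (t - γ i t)) ^ 2 +
          3 * G.payoffGap i (y (t + 1)) (y t) ^ 2 +
          3 * G.payoffGap i (y (t + 1)) (y (t + 1 - γ i (t + 1))) ^ 2 := by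
      intro t
      have ha := G.payoffGap_triangle i (y (t - γ i t)) (y t) (y (t + 1 - γ i (t + 1)))
      have hb := G.payoffGap_triangle i (y t) (y (t + 1)) (y (t + 1 - γ i (t + 1)))
      rw [G.payoffGap_comm i (y (t - γ i t)) (y t)] at ha
      rw [G.payoffGap_comm i (y t) (y (t + 1))] at hb
      have h0 := G.payoffGap_nonneg i (y (t - γ i t)) (y (t + 1 - γ i (t + 1)))
      refine (pow_le_pow_left₀ h0 (ha.trans (add_le_add_right hb _)) 2).trans ?_
      nlinarith [sq_nonneg (G.payoffGap i (y t) (y (t - γ i t)) - G.payoffGap i (y (t + 1)) (y t)),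
        sq_nonneg (G.payoffGap i (y t) (y (t - γ i t)) -
          G.payoffGap i (y (t + 1)) (y (t + 1 - γ i (t + 1)))),
        sq_nonneg (G.payoffGap i (y (t + 1)) (y t) -
          G.payoffGap i (y (t + 1)) (y (t + 1 - γ i (t + 1))))]
    have hsh := sum_range_le_sum_range_of_shift
      (f := fun t => G.payoffGap i (y (t + 1)) (y (t + 1 - γ i (t + 1))) ^ 2)
      (g := fun t => G.payoffGap i (y t) (y (t - γ i t)) ^ 2) (fun t => sq_nonneg _)
      (by simp [payoffGap_self]) (fun t => le_rfl) T
    have hs := Finset.sum_le_sum fun t (_ : t ∈ Finset.range T) => hpt t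
    simp only [Finset.sum_add_distrib, ← Finset.mul_sum] at hs
    rw [payoffJump, staleError, ← hy]
    linarith
  have h2 : ∑ i, ∑ t ∈ Finset.range T, G.payoffGap i (y (t + 1)) (y t) ^ 2 ≤
      (G.dmax * G.maxPayoff) ^ 2 * ∑ i, G.pathVariation η τ γ T i := by
    simp only [pathVariation, ← hy]
    rw [Finset.sum_comm, Finset.sum_comm (s := Finset.univ), Finset.mul_sum]
    exact Finset.sum_le_sum fun t _ => G.sum_payoffGap_sq_le _ _
  have h3 := Finset.sum_le_sum fun i (_ : i ∈ Finset.univ) => h1 i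
  rw [Finset.sum_add_distrib, ← Finset.mul_sum, ← Finset.mul_sum] at h3
  linarith

/-- Cauchy–Schwarz along the path: a delay of `γ` steps costs at most `γ` times the quadratic
variation of the last `γ` steps. -/
theorem l1Dist_omwuBar_sub_sq_le (G : PolymatrixGame V S) (η τ : ℝ) (γ : V → ℕ → ℕ) (s n : ℕ)
    (j : V) : l1Dist (G.omwuBar η τ γ s j) (G.omwuBar η τ γ (s - n) j) ^ 2 ≤
      ∑ r ∈ Finset.range s, (if s - r ≤ n then (n : ℝ) else 0) *
        l1Dist (G.omwuBar η τ γ (r + 1) j) (G.omwuBar η τ γ r j) ^ 2 := by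
  set y := fun t => G.omwuBar η τ γ t j
  have htel : ∀ b a, a ≤ b →
      l1Dist (y b) (y a) ≤ ∑ r ∈ Finset.Ico a b, l1Dist (y (r + 1)) (y r) := by
    intro b a hab
    induction b, hab using Nat.le_induction with
    | base => simp [l1Dist_self]
    | succ b hab ih =>
      rw [Finset.sum_Ico_succ_top hab]
      linarith [l1Dist_triangle (y (b + 1)) (y b) (y a)]
  have h1 := pow_le_pow_left₀ (l1Dist_nonneg _ _) (htel s (s - n) (Nat.sub_le _ _)) 2
  refine h1.trans (sq_sum_le_card_mul_sum_sq.trans ?_)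
  have hc : ((Finset.Ico (s - n) s).card : ℝ) ≤ n := by
    rw [Nat.card_Ico]; exact_mod_cast (by omega : s - (s - n) ≤ n)
  refine (mul_le_mul_of_nonneg_right hc (Finset.sum_nonneg fun _ _ => sq_nonneg _)).trans ?_
  simp only [ite_mul, zero_mul]
  rw [← Finset.sum_filter, Finset.mul_sum]
  refine Finset.sum_le_sum_of_subset_of_nonneg (fun r hr => ?_)
    (fun r _ _ => mul_nonneg (Nat.cast_nonneg n) (sq_nonneg _))
  rw [Finset.mem_Ico] at hr
  rw [Finset.mem_filter, Finset.mem_range]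
  omega

variable [∀ i, Nonempty (S i)]

theorem pathVariation_le (G : PolymatrixGame V S) {η : ℝ} (hη : 0 ≤ η) (τ : ℝ) (γ : V → ℕ → ℕ)
    (T : ℕ) (i : V) : G.pathVariation η τ γ T i ≤
      4 * G.extrapolationEntropy η τ γ T i + 2 * η ^ 2 * G.payoffJump η τ γ T i := by
  have hpt : ∀ t, l1Dist (G.omwuBar η τ γ (t + 1) i) (G.omwuBar η τ γ t i) ^ 2 ≤
      4 * relEntropy (G.omwuBar η τ γ (t + 1) i) (G.omwu η τ γ t i) +
        2 * l1Dist (G.omwu η τ γ t i) (G.omwuBar η τ γ t i) ^ 2 := by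
    intro t
    have h1 := l1Dist_triangle (G.omwuBar η τ γ (t + 1) i) (G.omwu η τ γ t i)
      (G.omwuBar η τ γ t i)
    have h2 := l1Dist_sq_le_two_mul_relEntropy (G.omwuBar_mem_stdSimplex η τ γ (t + 1) i)
      (G.omwu_mem_stdSimplex η τ γ t i) (G.omwu_pos η τ γ t i)
    have h3 := pow_le_pow_left₀ (l1Dist_nonneg _ _) h1 2
    nlinarith [sq_nonneg (l1Dist (G.omwuBar η τ γ (t + 1) i) (G.omwu η τ γ t i) -
      l1Dist (G.omwu η τ γ t i) (G.omwuBar η τ γ t i))]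
  have hsh := sum_range_le_sum_range_of_shift
    (f := fun t => η ^ 2 * G.payoffGap i (G.omwuBar η τ γ (t - γ i t))
      (G.omwuBar η τ γ (t + 1 - γ i (t + 1))) ^ 2)
    (g := fun t => l1Dist (G.omwu η τ γ t i) (G.omwuBar η τ γ t i) ^ 2)
    (fun t => by positivity) (by simp [omwu_zero, omwuBar_zero, l1Dist_self]) (fun t => by
      rw [omwu_succ, omwuBar_succ, ← mul_pow]
      refine pow_le_pow_left₀ (l1Dist_nonneg _ _) ?_ 2
      refine l1Dist_mwuStep_le hη (G.payoffGap_nonneg _ _ _) (G.omwu_pos η τ γ t i) fun k => ?_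
      rw [G.payoffGap_comm]
      exact G.abs_payoffVec_sub_le i _ _ k) T
  have hs := Finset.sum_le_sum fun t (_ : t ∈ Finset.range T) => hpt t
  rw [Finset.sum_add_distrib, ← Finset.mul_sum, ← Finset.mul_sum] at hs
  rw [← Finset.mul_sum] at hsh
  rw [pathVariation, extrapolationEntropy, payoffJump]
  linarith

/-- The regret of a single player, with the negative term that the stability of the iterates
provides. -/
theorem mul_regret_le [DecidableEq V] (G : PolymatrixGame V S) {η τ : ℝ} (hη : 0 ≤ η) (hτ : 0 < τ)
    (γ : V → ℕ → ℕ) (T : ℕ) (i : V) : η * G.regret τ (G.omwuBar η τ γ) i T ≤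
      Real.log (Fintype.card (S i)) - (1 - 2 * η * τ) * G.extrapolationEntropy η τ γ T i +
        η ^ 2 * G.payoffJump η τ γ T i + η * (G.staleError η τ γ T i / τ) := by
  obtain ⟨⟨p, hp, hpe⟩, -⟩ := G.isGreatest_fixedStrategyUtility τ (G.omwuBar η τ γ) i T
  set y := G.omwuBar η τ γ with hy
  have e : G.regret τ y i T = ∑ t ∈ Finset.range T,
      ((∑ k, (p k - y (t + 1) i k) * G.payoffVec i (y (t + 1)) k) +
        τ * (shannonEntropy p - shannonEntropy (y (t + 1) i))) := by
    rw [regret, ← hpe, fixedStrategyUtility, ← Finset.sum_sub_distrib, sum_Icc_one_eq_sum_range]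
    refine Finset.sum_congr rfl fun t _ => ?_
    rw [regUtility_update, regUtility, utility_eq_sum]
    simp only [sub_mul, Finset.sum_sub_distrib]
    ring
  have hstep : ∀ t, η * ((∑ k, (p k - y (t + 1) i k) * G.payoffVec i (y (t + 1)) k) +
        τ * (shannonEntropy p - shannonEntropy (y (t + 1) i))) ≤
      (relEntropy p (G.omwu η τ γ t i) - relEntropy p (G.omwu η τ γ (t + 1) i)) -
        (1 - 2 * η * τ) * relEntropy (y (t + 1) i) (G.omwu η τ γ t i) +
        η ^ 2 * G.payoffGap i (y (t - γ i t)) (y (t + 1 - γ i (t + 1))) ^ 2 +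
        η * (G.payoffGap i (y (t + 1)) (y (t + 1 - γ i (t + 1))) ^ 2 / τ) := by
    intro t
    rw [omwu_succ]
    exact regret_step_le hη hτ (G.payoffGap_nonneg _ _ _) (G.omwu_pos η τ γ t i)
      (G.omwu_mem_stdSimplex η τ γ t i) (G.abs_payoffVec_sub_le i _ _)
      (G.abs_payoffVec_sub_le i _ _) hp (G.omwuBar_succ η τ γ t i)
  have hs := Finset.sum_le_sum fun t (_ : t ∈ Finset.range T) => hstep t
  rw [← Finset.mul_sum, ← e] at hs
  simp only [Finset.sum_add_distrib, Finset.sum_sub_distrib] at hs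
  rw [← Finset.sum_sub_distrib, Finset.sum_range_sub', ← Finset.mul_sum, ← Finset.mul_sum,
    ← Finset.mul_sum, ← Finset.sum_div, omwu_zero] at hs
  have h0 := relEntropy_uniformVec_le hp
  have h1 := relEntropy_nonneg hp (G.omwu_mem_stdSimplex η τ γ T i) (G.omwu_pos η τ γ T i)
  rw [extrapolationEntropy, payoffJump, staleError, ← hy]
  linarith

theorem extrapolationEntropy_nonneg (G : PolymatrixGame V S) (η τ : ℝ) (γ : V → ℕ → ℕ) (T : ℕ)
    (i : V) : 0 ≤ G.extrapolationEntropy η τ γ T i :=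
  Finset.sum_nonneg fun t _ => relEntropy_nonneg (G.omwuBar_mem_stdSimplex η τ γ (t + 1) i)
    (G.omwu_mem_stdSimplex η τ γ t i) (G.omwu_pos η τ γ t i)

theorem mul_regret_le_staleError_add_pathVariation [DecidableEq V] (G : PolymatrixGame V S)
    {η τ : ℝ} (hη : 0 ≤ η) (hτ : 0 < τ) (hητ : η * τ ≤ 1 / 24) (γ : V → ℕ → ℕ) (T : ℕ) (i : V) :
    η * G.regret τ (G.omwuBar η τ γ) i T ≤ Real.log (Fintype.card (S i)) +
      η ^ 2 * (6 * ∑ j, G.staleError η τ γ T j +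
        3 * ((G.dmax * G.maxPayoff) ^ 2 * ∑ j, G.pathVariation η τ γ T j)) +
      η * ((∑ j, G.staleError η τ γ T j) / τ) := by
  have h1 := G.mul_regret_le hη hτ γ T i
  have h2 : G.payoffJump η τ γ T i ≤ ∑ j, G.payoffJump η τ γ T j :=
    Finset.single_le_sum (fun j _ => G.payoffJump_nonneg η τ γ T j) (Finset.mem_univ i)
  have h3 : G.staleError η τ γ T i ≤ ∑ j, G.staleError η τ γ T j :=
    Finset.single_le_sum (fun j _ => G.staleError_nonneg η τ γ T j) (Finset.mem_univ i)
  have h4 := mul_le_mul_of_nonneg_left (h2.trans (G.sum_payoffJump_le η τ γ T)) (sq_nonneg η)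
  have h5 := mul_le_mul_of_nonneg_left (div_le_div_of_nonneg_right h3 hτ.le) hη
  have h6 : 0 ≤ (1 - 2 * η * τ) * G.extrapolationEntropy η τ γ T i :=
    mul_nonneg (by linarith) (G.extrapolationEntropy_nonneg η τ γ T i)
  linarith

/-- Since the regrets add up to a nonnegative number, the total variation of the strategies is
controlled by the initial entropies, up to the error caused by the delays. -/
theorem sum_pathVariation_le {G : PolymatrixGame V S} (hG : G.IsZeroSum)
    {η τ : ℝ} (hη : 0 ≤ η) (hτ : 0 < τ) (hητ : η * τ ≤ 1 / 24) (γ : V → ℕ → ℕ) {T : ℕ}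
    (hT : 1 ≤ T) :
    11 / 48 * ∑ j, G.pathVariation η τ γ T j ≤ ∑ j, Real.log (Fintype.card (S j)) +
      3 / 2 * η ^ 2 * (6 * ∑ j, G.staleError η τ γ T j +
        3 * ((G.dmax * G.maxPayoff) ^ 2 * ∑ j, G.pathVariation η τ γ T j)) +
      η * ((∑ j, G.staleError η τ γ T j) / τ) := by
  classical
  have h0 := mul_nonneg hη (sum_regret_nonneg hG hτ.le (G.omwuBar_mem_stdSimplex η τ γ) hT)
  have h1 := Finset.sum_le_sum fun i (_ : i ∈ Finset.univ) => G.mul_regret_le hη hτ γ T i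
  simp only [Finset.sum_add_distrib, Finset.sum_sub_distrib, ← Finset.mul_sum,
    ← Finset.sum_div] at h1
  have h2 := Finset.sum_le_sum fun i (_ : i ∈ Finset.univ) => G.pathVariation_le hη τ γ T i
  simp only [Finset.sum_add_distrib, ← Finset.mul_sum] at h2
  have h3 := mul_le_mul_of_nonneg_left (G.sum_payoffJump_le η τ γ T) (sq_nonneg η)
  have hK : 0 ≤ ∑ i, G.extrapolationEntropy η τ γ T i :=
    Finset.sum_nonneg fun i _ => G.extrapolationEntropy_nonneg η τ γ T i
  have h4 : 11 / 12 * ∑ i, G.extrapolationEntropy η τ γ T i ≤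
      (1 - 2 * η * τ) * ∑ i, G.extrapolationEntropy η τ γ T i :=
    mul_le_mul_of_nonneg_right (by linarith) hK
  have h5 : 0 ≤ η ^ 2 * ∑ i, G.payoffJump η τ γ T i :=
    mul_nonneg (sq_nonneg η) (Finset.sum_nonneg fun i _ => G.payoffJump_nonneg η τ γ T i)
  linarith

end PolymatrixGame

/-! ### Random delays -/

section Delays

variable {V Ω : Type*} [MeasurableSpace Ω] {μ : Measure Ω}
  {γ : V → ℕ → Ω → ℕ} {E : ℕ → ℝ≥0} {σ : ℝ}

theorem RandomDelays.lintegral_tail_le (hγ : RandomDelays μ γ E σ) (i : V) (t ℓ : ℕ) :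
    ∫⁻ ω, ENNReal.ofReal (if ℓ ≤ γ i t ω then (γ i t ω : ℝ) else 0) ∂μ ≤ E ℓ := by
  have hm : MeasurableSet {ω | ℓ ≤ γ i t ω} :=
    measurableSet_le measurable_const (hγ.measurable i t)
  refine le_trans (le_of_eq ?_) (hγ.tail_le i t ℓ)
  rw [← lintegral_indicator hm]
  refine lintegral_congr fun ω => ?_
  by_cases h : ℓ ≤ γ i t ω <;> simp [Set.indicator, h]

theorem RandomDelays.integrable_tail (hγ : RandomDelays μ γ E σ) (i : V) (t ℓ : ℕ) :
    Integrable (fun ω => if ℓ ≤ γ i t ω then (γ i t ω : ℝ) else 0) μ := by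
  have hm : Measurable fun ω => if ℓ ≤ γ i t ω then (γ i t ω : ℝ) else 0 :=
    (measurable_of_countable fun n : ℕ => if ℓ ≤ n then (n : ℝ) else 0).comp (hγ.measurable i t)
  refine (lintegral_ofReal_ne_top_iff_integrable hm.aestronglyMeasurable
    (Filter.Eventually.of_forall fun ω => ?_)).1
    (ne_top_of_le_ne_top ENNReal.coe_ne_top (hγ.lintegral_tail_le i t ℓ))
  dsimp only [Pi.zero_apply]
  split_ifs <;> positivity

theorem RandomDelays.integral_tail_le (hγ : RandomDelays μ γ E σ) (i : V) (t ℓ : ℕ) :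
    ∫ ω, (if ℓ ≤ γ i t ω then (γ i t ω : ℝ) else 0) ∂μ ≤ E ℓ := by
  rw [integral_eq_lintegral_of_nonneg_ae (Filter.Eventually.of_forall fun ω => by
    dsimp only [Pi.zero_apply]; split_ifs <;> positivity)
    (hγ.integrable_tail i t ℓ).aestronglyMeasurable]
  exact ENNReal.toReal_le_coe_of_le_coe (hγ.lintegral_tail_le i t ℓ)

theorem RandomDelays.sum_le (hγ : RandomDelays μ γ E σ) (s : Finset ℕ) :
    ∑ ℓ ∈ s, (E ℓ : ℝ) ≤ σ ^ 2 := by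
  have h := (ENNReal.sum_le_tsum s).trans hγ.tsum_le
  rw [← ENNReal.ofNNReal_finsetSum, ← ENNReal.ofReal_coe_nnreal,
    ENNReal.ofReal_le_ofReal_iff (sq_nonneg σ)] at h
  exact_mod_cast h

/-- `F` depends only on the delays of the iterations before `N`. -/
def DependsOnDelaysBefore {β : Type*} (N : ℕ) (F : (V → ℕ → ℕ) → β) : Prop :=
  ∀ γ γ' : V → ℕ → ℕ, (∀ i, ∀ u < N, γ i u = γ' i u) → F γ = F γ'

variable [Fintype V]

/-- A function of finitely many delays factors through a countable discrete space. -/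
theorem DependsOnDelaysBefore.exists_factor {N : ℕ} {F : (V → ℕ → ℕ) → ℝ}
    (hF : DependsOnDelaysBefore N F) :
    ∃ Φ : (↥((Finset.univ : Finset V) ×ˢ Finset.range N) → ℕ) → ℝ,
      ∀ δ : V → ℕ → ℕ, F δ = Φ fun q => δ q.1.1 q.1.2 := by
  classical
  refine ⟨fun z => F fun i u =>
    if h : (i, u) ∈ (Finset.univ : Finset V) ×ˢ Finset.range N then z ⟨(i, u), h⟩ else 0,
    fun δ => hF _ _ fun i u hu => ?_⟩
  simp [hu]

theorem DependsOnDelaysBefore.measurable {N : ℕ} {F : (V → ℕ → ℕ) → ℝ}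
    (hF : DependsOnDelaysBefore N F) (hγ : RandomDelays μ γ E σ) :
    Measurable fun ω => F fun i t => γ i t ω := by
  obtain ⟨Φ, hΦ⟩ := hF.exists_factor
  simp only [hΦ]
  exact (measurable_of_countable Φ).comp (measurable_pi_lambda _ fun q => hγ.measurable _ _)

theorem DependsOnDelaysBefore.integrable [IsFiniteMeasure μ] {N : ℕ} {F : (V → ℕ → ℕ) → ℝ}
    (hF : DependsOnDelaysBefore N F) (hγ : RandomDelays μ γ E σ) {C : ℝ} (hC : ∀ δ, |F δ| ≤ C) :
    Integrable (fun ω => F fun i t => γ i t ω) μ :=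
  Integrable.of_bound (hF.measurable hγ).aestronglyMeasurable C
    (Filter.Eventually.of_forall fun _ => hC _)

theorem DependsOnDelaysBefore.indepFun {N : ℕ} {F : (V → ℕ → ℕ) → ℝ}
    (hF : DependsOnDelaysBefore N F) (hγ : RandomDelays μ γ E σ) {s : ℕ} (hs : N ≤ s) (i : V)
    (h : ℕ → ℝ) :
    IndepFun (fun ω => h (γ i s ω)) (fun ω => F fun i t => γ i t ω) μ := by
  classical
  obtain ⟨Φ, hΦ⟩ := hF.exists_factor
  have hd : Disjoint ({(i, s)} : Finset (V × ℕ)) ((Finset.univ : Finset V) ×ˢ Finset.range N) := by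
    simp [hs]
  have hi := hγ.indep.indepFun_finset _ _ hd fun q => hγ.measurable q.1 q.2
  have hc := hi.comp (φ := fun z : ↥({(i, s)} : Finset (V × ℕ)) → ℕ =>
      h (z ⟨(i, s), Finset.mem_singleton_self _⟩)) (ψ := Φ)
    (measurable_of_countable _) (measurable_of_countable _)
  simp only [hΦ]
  exact hc

end Delays

namespace PolymatrixGame

variable {V : Type*} {S : V → Type*} [Fintype V] [∀ i, Fintype (S i)]
  {Ω : Type*} [MeasurableSpace Ω] {μ : Measure Ω} {γ : V → ℕ → Ω → ℕ} {E : ℕ → ℝ≥0} {σ : ℝ}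

theorem dependsOnDelaysBefore_l1Dist (G : PolymatrixGame V S) (η τ : ℝ) (s N : ℕ) (hs : s ≤ N)
    (f : (V → ℕ → ℕ) → ℕ) (hf : DependsOnDelaysBefore N f) (hfs : ∀ δ, f δ ≤ N) (j : V) :
    DependsOnDelaysBefore N
      fun δ => l1Dist (G.omwuBar η τ δ s j) (G.omwuBar η τ δ (f δ) j) ^ 2 := by
  intro δ δ' h
  have hc := (G.omwu_congr η τ N δ δ' h).1
  dsimp only
  rw [hc s hs, hf δ δ' h, hc _ (hfs δ')]

variable [∀ i, Nonempty (S i)] [IsProbabilityMeasure μ]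

theorem abs_l1Dist_sq_le (G : PolymatrixGame V S) (η τ : ℝ) (δ : V → ℕ → ℕ) (s t : ℕ) (j : V) :
    |l1Dist (G.omwuBar η τ δ s j) (G.omwuBar η τ δ t j) ^ 2| ≤ 4 := by
  rw [abs_of_nonneg (sq_nonneg _)]
  have h1 := l1Dist_le_two (G.omwuBar_mem_stdSimplex η τ δ s j)
    (G.omwuBar_mem_stdSimplex η τ δ t j)
  have h0 := l1Dist_nonneg (G.omwuBar η τ δ s j) (G.omwuBar η τ δ t j)
  nlinarith

theorem integrable_step_sq (G : PolymatrixGame V S) (η τ : ℝ) (hγ : RandomDelays μ γ E σ) (r : ℕ)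
    (j : V) : Integrable (fun ω => l1Dist (G.omwuBar η τ (fun i t => γ i t ω) (r + 1) j)
      (G.omwuBar η τ (fun i t => γ i t ω) r j) ^ 2) μ :=
  (G.dependsOnDelaysBefore_l1Dist η τ (r + 1) (r + 1) le_rfl (fun _ => r) (fun _ _ _ => rfl)
    (fun _ => r.le_succ) j).integrable hγ fun δ => G.abs_l1Dist_sq_le η τ δ _ _ j

theorem integrable_stale_sq (G : PolymatrixGame V S) (η τ : ℝ) (hγ : RandomDelays μ γ E σ) (s : ℕ)
    (i j : V) : Integrable (fun ω => l1Dist (G.omwuBar η τ (fun i t => γ i t ω) s j)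
      (G.omwuBar η τ (fun i t => γ i t ω) (s - γ i s ω) j) ^ 2) μ :=
  (G.dependsOnDelaysBefore_l1Dist η τ s (s + 1) s.le_succ (fun δ => s - δ i s)
    (fun δ δ' h => by dsimp only; rw [h i s s.lt_succ_self])
    (fun _ => (Nat.sub_le _ _).trans s.le_succ) j).integrable hγ
    fun δ => G.abs_l1Dist_sq_le η τ δ _ _ j

theorem integrable_pathVariation (G : PolymatrixGame V S) (η τ : ℝ) (hγ : RandomDelays μ γ E σ)
    (T : ℕ) (i : V) : Integrable (fun ω => G.pathVariation η τ (fun i t => γ i t ω) T i) μ :=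
  integrable_finsetSum _ fun r _ => G.integrable_step_sq η τ hγ r i

theorem integrable_payoffGap_sq (G : PolymatrixGame V S) (η τ : ℝ) (hγ : RandomDelays μ γ E σ)
    (s : ℕ) (i : V) : Integrable (fun ω => G.payoffGap i
      (G.omwuBar η τ (fun i t => γ i t ω) s)
      (G.omwuBar η τ (fun i t => γ i t ω) (s - γ i s ω)) ^ 2) μ := by
  classical
  have hdep : DependsOnDelaysBefore (s + 1) fun δ : V → ℕ → ℕ => G.payoffGap i
      (G.omwuBar η τ δ s) (G.omwuBar η τ δ (s - δ i s)) ^ 2 := by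
    intro δ δ' h
    have hc := (G.omwu_congr η τ (s + 1) δ δ' h).1
    dsimp only
    rw [hc s s.le_succ, h i s s.lt_succ_self, hc _ ((Nat.sub_le _ _).trans s.le_succ)]
  refine hdep.integrable hγ (C := G.maxPayoff ^ 2 *
    (G.dmax * ∑ j ∈ G.graph.neighborFinset i, 4)) fun δ => ?_
  rw [abs_of_nonneg (sq_nonneg _)]
  refine (G.payoffGap_sq_le i _ _).trans ?_
  refine mul_le_mul_of_nonneg_left (mul_le_mul_of_nonneg_left ?_ (Nat.cast_nonneg _))
    (sq_nonneg _)
  convert Finset.sum_le_sum fun j (_ : j ∈ G.graph.neighborFinset i) =>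
    (le_abs_self _).trans (G.abs_l1Dist_sq_le η τ δ s (s - δ i s) j)

theorem integrable_staleError (G : PolymatrixGame V S) (η τ : ℝ) (hγ : RandomDelays μ γ E σ)
    (T : ℕ) (i : V) : Integrable (fun ω => G.staleError η τ (fun i t => γ i t ω) T i) μ :=
  integrable_finsetSum _ fun t _ => G.integrable_payoffGap_sq η τ hγ (t + 1) i

/-- The delay of round `s` is independent of the trajectory up to time `s`, so its weight can be
averaged separately. -/
theorem integral_stale_sq_le (G : PolymatrixGame V S) (η τ : ℝ) (hγ : RandomDelays μ γ E σ)
    (s : ℕ) (i j : V) :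
    ∫ ω, l1Dist (G.omwuBar η τ (fun i t => γ i t ω) s j)
      (G.omwuBar η τ (fun i t => γ i t ω) (s - γ i s ω) j) ^ 2 ∂μ ≤
    ∑ r ∈ Finset.range s, (E (s - r) : ℝ) *
      ∫ ω, l1Dist (G.omwuBar η τ (fun i t => γ i t ω) (r + 1) j)
        (G.omwuBar η τ (fun i t => γ i t ω) r j) ^ 2 ∂μ := by
  have hind : ∀ r ∈ Finset.range s, IndepFun
      (fun ω => if s - r ≤ γ i s ω then (γ i s ω : ℝ) else 0)
      (fun ω => l1Dist (G.omwuBar η τ (fun i t => γ i t ω) (r + 1) j)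
        (G.omwuBar η τ (fun i t => γ i t ω) r j) ^ 2) μ := by
    intro r hr
    exact (G.dependsOnDelaysBefore_l1Dist η τ (r + 1) (r + 1) le_rfl (fun _ => r)
      (fun _ _ _ => rfl) (fun _ => r.le_succ) j).indepFun hγ (Finset.mem_range.1 hr) i
      fun n => if s - r ≤ n then (n : ℝ) else 0
  have hint : ∀ r ∈ Finset.range s, Integrable (fun ω =>
      (if s - r ≤ γ i s ω then (γ i s ω : ℝ) else 0) *
        l1Dist (G.omwuBar η τ (fun i t => γ i t ω) (r + 1) j)
          (G.omwuBar η τ (fun i t => γ i t ω) r j) ^ 2) μ := fun r hr =>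
    (hind r hr).integrable_mul (hγ.integrable_tail i s (s - r)) (G.integrable_step_sq η τ hγ r j)
  refine (integral_mono (G.integrable_stale_sq η τ hγ s i j) (integrable_finsetSum _ hint)
    fun ω => G.l1Dist_omwuBar_sub_sq_le η τ (fun i t => γ i t ω) s (γ i s ω) j).trans ?_
  rw [integral_finsetSum _ hint]
  refine Finset.sum_le_sum fun r hr => ?_
  rw [(hind r hr).integral_fun_mul_eq_mul_integral
    (hγ.integrable_tail i s (s - r)).aestronglyMeasurable
    (G.integrable_step_sq η τ hγ r j).aestronglyMeasurable]
  exact mul_le_mul_of_nonneg_right (hγ.integral_tail_le i s (s - r))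
    (integral_nonneg fun ω => sq_nonneg _)

theorem sum_integral_stale_sq_le (G : PolymatrixGame V S) (η τ : ℝ) (hγ : RandomDelays μ γ E σ)
    (T : ℕ) (i j : V) :
    ∑ t ∈ Finset.range T, ∫ ω, l1Dist (G.omwuBar η τ (fun i t => γ i t ω) (t + 1) j)
      (G.omwuBar η τ (fun i t => γ i t ω) (t + 1 - γ i (t + 1) ω) j) ^ 2 ∂μ ≤
    σ ^ 2 * ∫ ω, G.pathVariation η τ (fun i t => γ i t ω) T j ∂μ := by
  refine (Finset.sum_le_sum fun t _ => G.integral_stale_sq_le η τ hγ (t + 1) i j).trans ?_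
  simp only [pathVariation]
  rw [integral_finsetSum _ fun r _ => G.integrable_step_sq η τ hγ r j,
    Finset.sum_comm' (t' := Finset.range T) (s' := fun r => Finset.Ico r T)
      (by intro t r; simp only [Finset.mem_range, Finset.mem_Ico]; omega), Finset.mul_sum]
  refine Finset.sum_le_sum fun r _ => ?_
  rw [← Finset.sum_mul]
  refine mul_le_mul_of_nonneg_right ?_ (integral_nonneg fun ω => sq_nonneg _)
  have hinj : Set.InjOn (fun t => t + 1 - r) (Finset.Ico r T : Set ℕ) := by
    intro a ha b hb hab
    simp only [Finset.coe_Ico, Set.mem_Ico] at ha hb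
    dsimp only at hab
    omega
  rw [← Finset.sum_image (f := fun ℓ => (E ℓ : ℝ)) hinj]
  exact hγ.sum_le _

theorem integral_sum_staleError_le (G : PolymatrixGame V S) (η τ : ℝ)
    (hγ : RandomDelays μ γ E σ) (T : ℕ) :
    ∫ ω, ∑ i, G.staleError η τ (fun i t => γ i t ω) T i ∂μ ≤
      (G.dmax * G.maxPayoff) ^ 2 * σ ^ 2 *
        ∫ ω, ∑ j, G.pathVariation η τ (fun i t => γ i t ω) T j ∂μ := by
  classical
  rw [integral_finsetSum _ fun i _ => G.integrable_staleError η τ hγ T i,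
    integral_finsetSum _ fun i _ => G.integrable_pathVariation η τ hγ T i]
  set w : V → ℝ := fun j => ∫ ω, G.pathVariation η τ (fun i t => γ i t ω) T j ∂μ with hw
  have hw0 : ∀ j, 0 ≤ w j := fun j => integral_nonneg fun ω => G.pathVariation_nonneg η τ _ T j
  have h1 : ∀ i, ∫ ω, G.staleError η τ (fun i t => γ i t ω) T i ∂μ ≤
      G.maxPayoff ^ 2 * (G.dmax * ∑ j ∈ G.graph.neighborFinset i, σ ^ 2 * w j) := by
    intro i
    have h2 : ∀ t, ∫ ω, G.payoffGap i (G.omwuBar η τ (fun i t => γ i t ω) (t + 1))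
        (G.omwuBar η τ (fun i t => γ i t ω) (t + 1 - γ i (t + 1) ω)) ^ 2 ∂μ ≤
        G.maxPayoff ^ 2 * (G.dmax * ∑ j ∈ G.graph.neighborFinset i,
          ∫ ω, l1Dist (G.omwuBar η τ (fun i t => γ i t ω) (t + 1) j)
            (G.omwuBar η τ (fun i t => γ i t ω) (t + 1 - γ i (t + 1) ω) j) ^ 2 ∂μ) := by
      intro t
      have hint := fun j (_ : j ∈ G.graph.neighborFinset i) =>
        G.integrable_stale_sq η τ hγ (t + 1) i j
      rw [← integral_finsetSum _ hint, ← integral_const_mul, ← integral_const_mul]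
      refine integral_mono (G.integrable_payoffGap_sq η τ hγ (t + 1) i)
        (((integrable_finsetSum _ hint).const_mul _).const_mul _) fun ω => ?_
      convert G.payoffGap_sq_le i _ _
    simp only [staleError]
    rw [integral_finsetSum _ fun t _ => G.integrable_payoffGap_sq η τ hγ (t + 1) i]
    refine (Finset.sum_le_sum fun t _ => h2 t).trans ?_
    rw [← Finset.mul_sum, ← Finset.mul_sum, Finset.sum_comm]
    gcongr with j hj
    exact G.sum_integral_stale_sq_le η τ hγ T i j
  calc ∑ i, ∫ ω, G.staleError η τ (fun i t => γ i t ω) T i ∂μ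
      ≤ ∑ i, G.maxPayoff ^ 2 * (G.dmax * ∑ j ∈ G.graph.neighborFinset i, σ ^ 2 * w j) :=
        Finset.sum_le_sum fun i _ => h1 i
    _ = G.maxPayoff ^ 2 * (G.dmax * ∑ i, ∑ j ∈ G.graph.neighborFinset i, σ ^ 2 * w j) := by
        rw [Finset.mul_sum, Finset.mul_sum]
    _ ≤ G.maxPayoff ^ 2 * (G.dmax * (G.dmax * ∑ j, σ ^ 2 * w j)) := by
        gcongr
        convert G.sum_sum_neighborFinset_le fun j => mul_nonneg (sq_nonneg σ) (hw0 j)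
    _ = (G.dmax * G.maxPayoff) ^ 2 * σ ^ 2 * ∑ j, w j := by
        rw [← Finset.mul_sum]; ring

/-! ### Integrability of the regret -/

theorem integrable_regret [DecidableEq V] (G : PolymatrixGame V S) (η τ : ℝ)
    (hγ : RandomDelays μ γ E σ) (T : ℕ) (i : V) :
    Integrable (fun ω => G.regret τ (G.omwuBar η τ fun j t => γ j t ω) i T) μ := by
  obtain ⟨C, hC⟩ := G.exists_abs_regUtility_le τ i
  have hdep : DependsOnDelaysBefore T
      fun δ : V → ℕ → ℕ => G.regret τ (G.omwuBar η τ δ) i T := by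
    intro δ δ' h
    have hc := (G.omwu_congr η τ T δ δ' h).1
    have h1 : G.fixedStrategyUtility τ (G.omwuBar η τ δ) i T =
        G.fixedStrategyUtility τ (G.omwuBar η τ δ') i T := by
      funext p
      exact Finset.sum_congr rfl fun t ht => by rw [hc t (Finset.mem_Icc.1 ht).2]
    dsimp only [regret]
    rw [h1]
    congr 1
    exact Finset.sum_congr rfl fun t ht => by rw [hc t (Finset.mem_Icc.1 ht).2]
  refine hdep.integrable hγ (C := ∑ t ∈ Finset.Icc 1 T, C + ∑ t ∈ Finset.Icc 1 T, C) fun δ => ?_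
  obtain ⟨⟨p, hp, hpe⟩, -⟩ := G.isGreatest_fixedStrategyUtility τ (G.omwuBar η τ δ) i T
  rw [regret, ← hpe]
  refine (abs_sub _ _).trans (add_le_add ?_ ?_)
  · refine (Finset.abs_sum_le_sum_abs _ _).trans (Finset.sum_le_sum fun t _ => hC _ fun j => ?_)
    by_cases hj : j = i
    · subst hj; rwa [Function.update_self]
    · rw [Function.update_of_ne hj]; exact G.omwuBar_mem_stdSimplex η τ δ t j
  · exact (Finset.abs_sum_le_sum_abs _ _).trans
      (Finset.sum_le_sum fun t _ => hC _ fun j => G.omwuBar_mem_stdSimplex η τ δ t j)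

end PolymatrixGame

/-! ### The expected regret -/

theorem mainTheorem6 {V : Type*} [Fintype V] [DecidableEq V] {S : V → Type*}
    [∀ i, Fintype (S i)] [∀ i, Nonempty (S i)]
    (G : PolymatrixGame V S) (hG : G.IsZeroSum)
    {Ω : Type*} [MeasurableSpace Ω] (μ : Measure Ω) [IsProbabilityMeasure μ]
    (γ : V → ℕ → Ω → ℕ) (E : ℕ → ℝ≥0) (σ : ℝ) (hσ : 0 < σ) (hγ : RandomDelays μ γ E σ)
    (τ η : ℝ) (hτ0 : 0 < τ) (hτ : τ < min 1 G.maxPayoff)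
    (hη0 : 0 < η)
    (hη : η ≤ τ / (24 * (G.dmax : ℝ) ^ 2 * G.maxPayoff ^ 2 * (σ ^ 2 + 1)))
    (T : ℕ) (hT : 1 ≤ T) (i : V) :
    Integrable (fun ω => G.regret τ (G.omwuBar η τ fun j t => γ j t ω) i T) μ ∧
    ∫ ω, G.regret τ (G.omwuBar η τ fun j t => γ j t ω) i T ∂μ ≤
      1 / η * Real.log (Fintype.card (S i)) +
        8 * (G.dmax : ℝ) * G.maxPayoff * ((G.dmax : ℝ) * G.maxPayoff / τ + 2) * (σ ^ 2 + 1) *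
          ∑ j, Real.log (Fintype.card (S j)) := by
  have hint := G.integrable_regret η τ hγ T i
  refine ⟨hint, ?_⟩
  obtain ⟨hτ1, hτa⟩ := lt_min_iff.1 hτ
  set a := G.maxPayoff with ha
  set d : ℝ := (G.dmax : ℝ) with hd
  set L := ∑ j, Real.log (Fintype.card (S j)) with hL
  have hL0 : 0 ≤ L := Finset.sum_nonneg fun j _ => Real.log_natCast_nonneg _
  have ha0 : 0 < a := hτ0.trans hτa
  -- If the graph had no edges, the right-hand side of `hη` would be `τ / 0 = 0`.
  have hd1 : 1 ≤ d := by
    rcases Nat.eq_zero_or_pos G.dmax with h | h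
    · rw [hd, h] at hη
      norm_num at hη
      linarith
    · rw [hd]
      exact_mod_cast h
  set B := (d * a) ^ 2 with hB
  have hτda : τ ≤ d * a := by nlinarith
  have hB0 : 0 < B := by positivity
  have hs1 : 0 < σ ^ 2 + 1 := by positivity
  have hηB : 24 * (η * (B * (σ ^ 2 + 1))) ≤ τ := by
    rw [le_div_iff₀ (by positivity)] at hη
    calc 24 * (η * (B * (σ ^ 2 + 1))) = η * (24 * d ^ 2 * a ^ 2 * (σ ^ 2 + 1)) := by
          rw [hB]; ring
      _ ≤ τ := hη
  have hηB' : 24 * (η * B) ≤ τ := by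
    have : 0 ≤ η * (B * σ ^ 2) := by positivity
    nlinarith
  have hητ : η * τ ≤ 1 / 24 := by
    have h1 : τ ^ 2 ≤ B := pow_le_pow_left₀ hτ0.le hτda 2
    have h2 : 24 * (η * τ ^ 2) ≤ τ := by nlinarith
    have h3 : τ * (24 * (η * τ)) ≤ τ * 1 := by linarith
    linarith [le_of_mul_le_mul_left h3 hτ0]
  set Q : Ω → ℝ := fun ω => ∑ j, G.staleError η τ (fun i t => γ i t ω) T j with hQ
  set W : Ω → ℝ := fun ω => ∑ j, G.pathVariation η τ (fun i t => γ i t ω) T j with hW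
  have hQi : Integrable Q μ := integrable_finsetSum _ fun j _ => G.integrable_staleError η τ hγ T j
  have hWi : Integrable W μ :=
    integrable_finsetSum _ fun j _ => G.integrable_pathVariation η τ hγ T j
  have hQW : ∫ ω, Q ω ∂μ ≤ B * σ ^ 2 * ∫ ω, W ω ∂μ := G.integral_sum_staleError_le η τ hγ T
  set q := ∫ ω, Q ω ∂μ with hq
  set w := ∫ ω, W ω ∂μ with hw
  have hw0 : 0 ≤ w := integral_nonneg fun ω =>
    Finset.sum_nonneg fun j _ => G.pathVariation_nonneg η τ _ T j
  -- The two pathwise inequalities in expectation.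
  have hI : Integrable (fun ω => 6 * Q ω + 3 * (B * W ω)) μ :=
    (hQi.const_mul 6).add ((hWi.const_mul B).const_mul 3)
  have eI : ∫ ω, (6 * Q ω + 3 * (B * W ω)) ∂μ = 6 * q + 3 * (B * w) := by
    rw [integral_add (hQi.const_mul 6) ((hWi.const_mul B).const_mul 3), integral_const_mul,
      integral_const_mul, integral_const_mul]
  have eaff : ∀ b c : ℝ, ∫ ω, (b + c * (6 * Q ω + 3 * (B * W ω)) + η * (Q ω / τ)) ∂μ =
      b + c * (6 * q + 3 * (B * w)) + η * (q / τ) := by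
    intro b c
    have hb : Integrable (fun ω => b + c * (6 * Q ω + 3 * (B * W ω))) μ :=
      (integrable_const b).add (hI.const_mul c)
    rw [integral_add hb ((hQi.div_const τ).const_mul η),
      integral_add (integrable_const b) (hI.const_mul c), integral_const_mul, integral_const_mul,
      integral_div, eI, integral_const, probReal_univ, one_smul]
  have hiaff : ∀ b c : ℝ,
      Integrable (fun ω => b + c * (6 * Q ω + 3 * (B * W ω)) + η * (Q ω / τ)) μ := fun b c =>
    ((integrable_const b).add (hI.const_mul c)).add ((hQi.div_const τ).const_mul η)
  have hvar : 11 / 48 * w ≤ L + 3 / 2 * η ^ 2 * (6 * q + 3 * (B * w)) + η * (q / τ) := by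
    rw [← eaff, hw, ← integral_const_mul]
    exact integral_mono (hWi.const_mul _) (hiaff _ _) fun ω =>
      PolymatrixGame.sum_pathVariation_le hG hη0.le hτ0 hητ _ hT
  have hreg : η * ∫ ω, G.regret τ (G.omwuBar η τ fun j t => γ j t ω) i T ∂μ ≤
      Real.log (Fintype.card (S i)) + η ^ 2 * (6 * q + 3 * (B * w)) + η * (q / τ) := by
    rw [← eaff, ← integral_const_mul]
    exact integral_mono (hint.const_mul _) (hiaff _ _) fun ω =>
      G.mul_regret_le_staleError_add_pathVariation hη0.le hτ0 hητ _ T i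
  -- The error terms, by the choice of the step size.
  have herr : η * (6 * q + 3 * (B * w)) ≤ τ / 4 * w := by
    have h1 : 6 * q + 3 * (B * w) ≤ 6 * (B * (σ ^ 2 + 1)) * w := by
      have : 0 ≤ B * w := by positivity
      linarith
    have h2 := mul_le_mul_of_nonneg_left h1 hη0.le
    have h3 := mul_le_mul_of_nonneg_right hηB hw0
    linarith
  have hqτ : q / τ ≤ B * σ ^ 2 / τ * w := by
    rw [div_mul_eq_mul_div]
    exact div_le_div_of_nonneg_right hQW hτ0.le
  have hηq : η * (q / τ) ≤ 1 / 24 * w := by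
    have h1 : η * (B * σ ^ 2) / τ ≤ 1 / 24 := by
      rw [div_le_iff₀ hτ0]
      nlinarith [mul_pos hη0 hB0]
    have h2 := mul_le_mul_of_nonneg_left hqτ hη0.le
    have h3 := mul_le_mul_of_nonneg_right h1 hw0
    calc η * (q / τ) ≤ η * (B * σ ^ 2 / τ * w) := h2
      _ = η * (B * σ ^ 2) / τ * w := by ring
      _ ≤ _ := h3
  have hw8 : w ≤ 8 * L := by
    have h1 := mul_le_mul_of_nonneg_left herr hη0.le
    have h2 := mul_le_mul_of_nonneg_right hητ hw0
    linarith
  have hfin : τ / 4 * w + B * σ ^ 2 / τ * w ≤ 8 * d * a * (d * a / τ + 2) * (σ ^ 2 + 1) * L := by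
    have h1 : τ / 4 * w ≤ 16 * (d * a) * (σ ^ 2 + 1) * L := by
      have : τ / 4 * w ≤ (d * a) / 4 * (8 * L) := by gcongr
      have h' : 0 ≤ d * a * L := by positivity
      have h'' : 0 ≤ d * a * L * σ ^ 2 := by positivity
      nlinarith
    have h2 : B * σ ^ 2 / τ * w ≤ B * (σ ^ 2 + 1) / τ * (8 * L) := by
      gcongr
      linarith
    have h3 : 8 * d * a * (d * a / τ + 2) * (σ ^ 2 + 1) * L =
        16 * (d * a) * (σ ^ 2 + 1) * L + B * (σ ^ 2 + 1) / τ * (8 * L) := by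
      rw [hB]; ring
    linarith
  have hmul : η * ∫ ω, G.regret τ (G.omwuBar η τ fun j t => γ j t ω) i T ∂μ ≤
      η * (1 / η * Real.log (Fintype.card (S i)) +
        8 * d * a * (d * a / τ + 2) * (σ ^ 2 + 1) * L) := by
    have h1 := mul_le_mul_of_nonneg_left (add_le_add herr hqτ) hη0.le
    have h2 := mul_le_mul_of_nonneg_left hfin hη0.le
    have h3 : η * (1 / η * Real.log (Fintype.card (S i))) = Real.log (Fintype.card (S i)) := by
      rw [← mul_assoc, mul_one_div_cancel hη0.ne', one_mul]
    rw [mul_add, h3]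
    linarith
  exact le_of_mul_le_mul_left hmul hη0
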